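/- **Conventions.** Let $\Box$ be the category whose objects are the posets $[1]^n=\{0\le 1\}^n$ ($n\ge 0$) and whose morphisms are the monotone maps generated under composition by the faces $\partial_{i,\varepsilon}\colon[1]^{n-1}\to[1]^n$ ($1\le i\le n$, $\varepsilon\in\{0,1\}$; insert $\varepsilon$ as $i$-th coordinate), the degeneracies $\sigma_i\colon[1]^n\to[1]^{n-1}$ ($1\le i\le n$; delete the $i$-th coordinate) and the connections $\gamma_{i,\varepsilon}\colon[1]^n\to[1]^{n-1}$ ($1\le i\le n-1$; replace $x_i,x_{i+1}$ by $\max(x_i,x_{i+1})$ if $\varepsilon=0$ and by $\min(x_i,x_{i+1})$ if $\varepsilon=1$). A cubical set is a presheaf of sets on $\Box$; $\mathsf{cSet}$ is the category of cubical sets, $\Box^n$ is represented by $[1]^n$, and operators act on cubes on the right. The geometric product $\otimes$ on $\mathsf{cSet}$ is the left Kan extension of $([1]^m,[1]^n)\mapsto\Box^{m+n}$ along the Yoneda embeddings. **Cubical quasicategories.** For $n\ge 2$, $1\le i\le n$, $\varepsilon\in\{0,1\}$, the open box $\sqcap^n_{i,\varepsilon}\subset\Box^n$ is the union of all faces of $\Box^n$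 except $\partial_{i,\varepsilon}$; its critical edge is the edge $[1]\to[1]^n$ whose $i$-th coordinate is the identity and whose other coordinates are constant at $1-\varepsilon$. The inner open box $\widehat\sqcap^n_{i,\varepsilon}$ and the inner cube $\widehat\Box^n_{i,\varepsilon}$ are obtained from $\sqcap^n_{i,\varepsilon}$ and $\Box^n$ by collapsing the critical edge to a point. A cubical quasicategory is a cubical set $X$ such that $X\to\Box^0$ has the right lifting property with respect to all the inclusions $\widehat\sqcap^n_{i,\varepsilon}\hookrightarrow\widehat\Box^n_{i,\varepsilon}$. **Cones.** The cone $CX$ on a cubical set $X$ is the pushout of $\Box^0\leftarrow X\xrightarrow{\partial_{1,1}\otimes X}\Box^1\otimes X$. Put $C^{m,n}=C^n\Box^m$ for $m,n\ge 0$. It is a quotient of $\Box^{m+n}=(\Box^1)^{\otimes n}\otimes\Box^m$, so that an $(m,n)$-cone $x\colon C^{m,n}\to X$ is determined by its underlying cube $\Box^{m+n}\to C^{m,n}\to X$. Below, cones are identified with their underlying cubes, and faces, degeneracies and connections of cones are those of the underlying cubes; a cube is called an $(m,n)$-cone if it factors through $C^{m,n}$. **Theorem.** Every cubical quasicategory $X$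 admits a coherent family of composites, i.e. a family of functions $$\theta^{m,n}\colon \mathsf{cSet}(C^{m,n},X)\to\mathsf{cSet}(C^{m,n+1},X)\qquad(m,n\ge 0)$$ satisfying the following identities, for all $m,n\geq 0$ and all indices for which the expressions are defined (all cubes to which some $\theta^{p,q}$ is applied below being $(p,q)$-cones): - $(\Theta 1)$ for $x\colon C^{m,n}\to X$ and $1\le i\le n$: $\theta^{m,n}(x)\partial_{i,0}=\theta^{m,n-1}(x\partial_{i,0})$; - $(\Theta 2)$ for $x\colon C^{m,n}\to X$: $\theta^{m,n}(x)\partial_{n+1,0}=x$; - $(\Theta 3)$ for $m\ge1$, $x\colon C^{m,n}\to X$ and $n+2\le i\le m+n+1$: $\theta^{m,n}(x)\partial_{i,1}=\theta^{m-1,n}(x\partial_{i-1,1})$; - $(\Theta 4)$ for $m\ge1$, $x\colon C^{m-1,n}\to X$ and $n+1\le i\le m+n$: $\theta^{m,n}(x\sigma_i)=\theta^{m-1,n}(x)\sigma_{i+1}$; - $(\Theta 5)$ for $n\ge1$, $x\colon C^{m,n-1}\to X$ and $1\le i\le n-1$: $\theta^{m,n}(x\gamma_{i,0})=\theta^{m,n-1}(x)\gamma_{i,0}$;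 - $(\Theta 6)$ for $m\ge1$, $x\colon C^{m-1,n}\to X$, $n+1\le i\le m+n-1$ and $\varepsilon\in\{0,1\}$: $\theta^{m,n}(x\gamma_{i,\varepsilon})=\theta^{m-1,n}(x)\gamma_{i+1,\varepsilon}$; - $(\Theta 7)$ for $n\ge1$ and $x\colon C^{m,n-1}\to X$: $\theta^{m,n}(\theta^{m,n-1}(x))=\theta^{m,n-1}(x)\gamma_{n,0}$; - $(\Theta 8)$ for $m\ge1$ and $x\colon C^{m-1,n+1}\to X$ (which is also an $(m,n)$-cone): $\theta^{m,n}(x)=x\gamma_{n+1,0}$. -/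

import Mathlib

open CategoryTheory CategoryTheory.Limits Opposite

universe u

namespace Cubical

/-! ### The box category

Coordinates of `[1]ⁿ` are numbered `0, …, n - 1`, and `[1]` is `Bool` with `false < true`.
Thus the operators written here with index `i` are the usual ones with index `i + 1`. -/

/-- The poset `[1]ⁿ`. -/
abbrev Vert (n : ℕ) : Type := Fin n → Bool

/-- The face `∂_{i,ε} : [1]ⁿ → [1]ⁿ⁺¹`, inserting `ε` as the `i`-th coordinate. -/
def faceMap {n : ℕ} (i : Fin (n + 1)) (ε : Bool) : Vert n →o Vert (n + 1) where
  toFun x j :=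
    if h : j.1 < i.1 then x ⟨j.1, by omega⟩
    else if h' : j.1 = i.1 then ε
    else x ⟨j.1 - 1, by omega⟩
  monotone' x y hxy j := by
    dsimp only
    split_ifs
    · exact hxy _
    · exact le_rfl
    · exact hxy _

/-- The degeneracy `σ_i : [1]ⁿ⁺¹ → [1]ⁿ`, deleting the `i`-th coordinate. -/
def degenMap {n : ℕ} (i : Fin (n + 1)) : Vert (n + 1) →o Vert n where
  toFun x j := if j.1 < i.1 then x ⟨j.1, by omega⟩ else x ⟨j.1 + 1, by omega⟩
  monotone' x y hxy j := by
    dsimp only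
    split_ifs <;> exact hxy _

/-- The connection `γ_{i,ε} : [1]ⁿ⁺¹ → [1]ⁿ`, replacing the coordinates `i` and `i + 1` by their
maximum (if `ε = 0`) or their minimum (if `ε = 1`). -/
def connMap {n : ℕ} (i : Fin n) (ε : Bool) : Vert (n + 1) →o Vert n where
  toFun x j :=
    if j.1 < i.1 then x ⟨j.1, by omega⟩
    else if j.1 = i.1 then
      if ε = true then min (x ⟨i.1, by omega⟩) (x ⟨i.1 + 1, by omega⟩)
      else max (x ⟨i.1, by omega⟩) (x ⟨i.1 + 1, by omega⟩)
    else x ⟨j.1 + 1, by omega⟩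
  monotone' x y hxy j := by
    dsimp only
    split_ifs
    · exact hxy _
    · exact min_le_min (hxy _) (hxy _)
    · exact max_le_max (hxy _) (hxy _)
    · exact hxy _

theorem faceMap_apply {n : ℕ} (i : Fin (n + 1)) (ε : Bool) (x : Vert n) (j : Fin (n + 1)) :
    faceMap i ε x j =
      if h : j.1 < i.1 then x ⟨j.1, by omega⟩
      else if h' : j.1 = i.1 then ε
      else x ⟨j.1 - 1, by omega⟩ := rfl

theorem degenMap_apply {n : ℕ} (i : Fin (n + 1)) (x : Vert (n + 1)) (j : Fin n) :
    degenMap i x j =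
      if j.1 < i.1 then x ⟨j.1, by omega⟩ else x ⟨j.1 + 1, by omega⟩ := rfl

theorem connMap_apply {n : ℕ} (i : Fin n) (ε : Bool) (x : Vert (n + 1)) (j : Fin n) :
    connMap i ε x j =
      if j.1 < i.1 then x ⟨j.1, by omega⟩
      else if j.1 = i.1 then
        if ε = true then min (x ⟨i.1, by omega⟩) (x ⟨i.1 + 1, by omega⟩)
        else max (x ⟨i.1, by omega⟩) (x ⟨i.1 + 1, by omega⟩)
      else x ⟨j.1 + 1, by omega⟩ := rfl

/-- The maps of posets generated under composition by faces, degeneracies and connections. -/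
inductive IsBoxMap : ∀ {m n : ℕ}, (Vert m →o Vert n) → Prop
  | id (n : ℕ) : IsBoxMap (OrderHom.id : Vert n →o Vert n)
  | comp {l m n : ℕ} {g : Vert m →o Vert n} {f : Vert l →o Vert m} :
      IsBoxMap g → IsBoxMap f → IsBoxMap (g.comp f)
  | face {n : ℕ} (i : Fin (n + 1)) (ε : Bool) : IsBoxMap (faceMap i ε)
  | degen {n : ℕ} (i : Fin (n + 1)) : IsBoxMap (degenMap i)
  | conn {n : ℕ} (i : Fin n) (ε : Bool) : IsBoxMap (connMap i ε)

/-- The box category: the object `⟨n⟩` is the poset `[1]ⁿ`. -/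
structure Box : Type where
  dim : ℕ

instance : Category Box where
  Hom m n := { f : Vert m.dim →o Vert n.dim // IsBoxMap f }
  id n := ⟨OrderHom.id, IsBoxMap.id n.dim⟩
  comp f g := ⟨g.1.comp f.1, g.2.comp f.2⟩

namespace Box

/-- The face `∂_{i,ε}` as a morphism of the box category. -/
def face {n : ℕ} (i : Fin (n + 1)) (ε : Bool) : Box.mk n ⟶ Box.mk (n + 1) :=
  ⟨faceMap i ε, IsBoxMap.face i ε⟩

/-- The degeneracy `σ_i` as a morphism of the box category. -/
def degen {n : ℕ} (i : Fin (n + 1)) : Box.mk (n + 1) ⟶ Box.mk n :=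
  ⟨degenMap i, IsBoxMap.degen i⟩

/-- The connection `γ_{i,ε}` as a morphism of the box category. -/
def conn {n : ℕ} (i : Fin n) (ε : Bool) : Box.mk (n + 1) ⟶ Box.mk n :=
  ⟨connMap i ε, IsBoxMap.conn i ε⟩

/-- The identification `[1]ᵃ = [1]ᵇ` for `a = b`. -/
def cast {a b : ℕ} (h : a = b) : Box.mk a ⟶ Box.mk b := eqToHom (congrArg Box.mk h)

theorem hom_ext {a b : Box} {f g : a ⟶ b} (h : ∀ x j, f.1 x j = g.1 x j) : f = g :=
  Subtype.ext (OrderHom.ext _ _ (funext fun x => funext fun j => h x j))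

theorem comp_val {a b c : Box} (f : a ⟶ b) (g : b ⟶ c) (x : Vert a.dim) :
    (f ≫ g).1 x = g.1 (f.1 x) := rfl

theorem id_val {a : Box} (x : Vert a.dim) : (𝟙 a : a ⟶ a).1 x = x := rfl

theorem cast_val {a b : ℕ} (h : a = b) (x : Vert a) (j : Fin b) :
    (cast h).1 x j = x ⟨j.1, by omega⟩ := by
  subst h; rfl

end Box

/-! ### The product `[1]ᵐ ⊗ [1]ⁿ = [1]ᵐ⁺ⁿ` on the box category -/

/-- The product of two maps, acting on the first and on the last coordinates respectively. -/
def prodMap {a b c d : ℕ} (f : Vert a →o Vert b) (g : Vert c →o Vert d) :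
    Vert (a + c) →o Vert (b + d) where
  toFun x j :=
    if h : j.1 < b then f (fun i => x ⟨i.1, by omega⟩) ⟨j.1, h⟩
    else g (fun i => x ⟨a + i.1, by omega⟩) ⟨j.1 - b, by omega⟩
  monotone' x y hxy j := by
    dsimp only
    split_ifs
    · exact f.monotone (fun i => hxy _) _
    · exact g.monotone (fun i => hxy _) _

theorem prodMap_apply {a b c d : ℕ} (f : Vert a →o Vert b) (g : Vert c →o Vert d)
    (x : Vert (a + c)) (j : Fin (b + d)) :
    prodMap f g x j =
      if h : j.1 < b then f (fun i => x ⟨i.1, by omega⟩) ⟨j.1, h⟩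
      else g (fun i => x ⟨a + i.1, by omega⟩) ⟨j.1 - b, by omega⟩ := rfl

theorem prodMap_comp {a b c a' b' c' : ℕ} (g : Vert b →o Vert c) (f : Vert a →o Vert b)
    (g' : Vert b' →o Vert c') (f' : Vert a' →o Vert b') :
    prodMap (g.comp f) (g'.comp f') = (prodMap g g').comp (prodMap f f') := by
  refine OrderHom.ext _ _ (funext fun x => funext fun j => ?_)
  change prodMap (g.comp f) (g'.comp f') x j = prodMap g g' (prodMap f f' x) j
  simp only [prodMap_apply, OrderHom.comp_coe, Function.comp_apply]
  split_ifs with h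
  · refine congrFun (congrArg g (funext fun i => ?_)) _
    simp
  · refine congrFun (congrArg g' (funext fun i => ?_)) _
    simp

theorem isBoxMap_of_cast {a b c d : ℕ} (hab : a = b) (hcd : c = d) {f : Vert b →o Vert c}
    (hf : IsBoxMap f) (g : Vert a →o Vert d)
    (h : ∀ x j, g x j = f (fun i => x ⟨i.1, by omega⟩) ⟨j.1, by omega⟩) : IsBoxMap g := by
  subst hab; subst hcd
  have : g = f := by
    refine OrderHom.ext _ _ (funext fun x => funext fun j => ?_)
    exact h x j
  rwa [this]

theorem prodMap_id_right {a b : ℕ} {f : Vert a →o Vert b} (hf : IsBoxMap f) (c : ℕ) :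
    IsBoxMap (prodMap f (OrderHom.id : Vert c →o Vert c)) := by
  induction hf with
  | id n =>
    refine isBoxMap_of_cast rfl rfl (IsBoxMap.id (n + c)) _ fun x j => ?_
    simp only [prodMap_apply, OrderHom.id_coe, id]
    split_ifs
    · rfl
    · exact congrArg x (Fin.ext (by first | rfl | omega | (dsimp only; omega)))
  | @comp l m n g f _ _ hg hf =>
    have := hg.comp hf
    rwa [← prodMap_comp] at this
  | @face n i ε =>
    refine isBoxMap_of_cast (b := n + c) (c := n + c + 1) rfl (by omega)
      (IsBoxMap.face ⟨i.1, by omega⟩ ε) _ fun x j => ?_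
    simp only [prodMap_apply, faceMap_apply, OrderHom.id_coe, id]
    split_ifs <;> first
      | rfl
      | omega
      | exact congrArg x (Fin.ext (by first | rfl | omega | (dsimp only; omega)))
  | @degen n i =>
    refine isBoxMap_of_cast (b := n + c + 1) (c := n + c) (by omega) rfl
      (IsBoxMap.degen ⟨i.1, by omega⟩) _ fun x j => ?_
    simp only [prodMap_apply, degenMap_apply, OrderHom.id_coe, id]
    split_ifs <;> first
      | rfl
      | omega
      | exact congrArg x (Fin.ext (by first | rfl | omega | (dsimp only; omega)))
  | @conn n i ε =>
    refine isBoxMap_of_cast (b := n + c + 1) (c := n + c) (by omega) rfl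
      (IsBoxMap.conn ⟨i.1, by omega⟩ ε) _ fun x j => ?_
    simp only [prodMap_apply, connMap_apply, OrderHom.id_coe, id]
    split_ifs <;> first
      | rfl
      | omega
      | exact congrArg x (Fin.ext (by first | rfl | omega | (dsimp only; omega)))

theorem prodMap_id_left (c : ℕ) {a b : ℕ} {f : Vert a →o Vert b} (hf : IsBoxMap f) :
    IsBoxMap (prodMap (OrderHom.id : Vert c →o Vert c) f) := by
  induction hf with
  | id n =>
    refine isBoxMap_of_cast rfl rfl (IsBoxMap.id (c + n)) _ fun x j => ?_
    simp only [prodMap_apply, OrderHom.id_coe, id]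
    split_ifs
    · rfl
    · exact congrArg x (Fin.ext (by first | rfl | omega | (dsimp only; omega)))
  | @comp l m n g f _ _ hg hf =>
    have := hg.comp hf
    rwa [← prodMap_comp] at this
  | @face n i ε =>
    refine isBoxMap_of_cast (b := c + n) (c := c + n + 1) rfl rfl
      (IsBoxMap.face ⟨c + i.1, by omega⟩ ε) _ fun x j => ?_
    simp only [prodMap_apply, faceMap_apply, OrderHom.id_coe, id]
    split_ifs <;> first
      | rfl
      | omega
      | exact congrArg x (Fin.ext (by first | rfl | omega | (dsimp only; omega)))
  | @degen n i =>
    refine isBoxMap_of_cast (b := c + n + 1) (c := c + n) rfl rfl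
      (IsBoxMap.degen ⟨c + i.1, by omega⟩) _ fun x j => ?_
    simp only [prodMap_apply, degenMap_apply, OrderHom.id_coe, id]
    split_ifs <;> first
      | rfl
      | omega
      | exact congrArg x (Fin.ext (by first | rfl | omega | (dsimp only; omega)))
  | @conn n i ε =>
    refine isBoxMap_of_cast (b := c + n + 1) (c := c + n) rfl rfl
      (IsBoxMap.conn ⟨c + i.1, by omega⟩ ε) _ fun x j => ?_
    simp only [prodMap_apply, connMap_apply, OrderHom.id_coe, id]
    split_ifs <;> first
      | rfl
      | omega
      | exact congrArg x (Fin.ext (by first | rfl | omega | (dsimp only; omega)))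

namespace Box

/-- The functor `Box × Box → Box`, `([1]ᵐ, [1]ⁿ) ↦ [1]ᵐ⁺ⁿ`, on morphisms. -/
def prod {a b c d : ℕ} (f : Box.mk a ⟶ Box.mk b) (g : Box.mk c ⟶ Box.mk d) :
    Box.mk (a + c) ⟶ Box.mk (b + d) :=
  ⟨prodMap f.1 g.1, by
    have := (prodMap_id_right f.2 d).comp (prodMap_id_left a g.2)
    rwa [← prodMap_comp] at this⟩

theorem prod_id (a c : ℕ) : prod (𝟙 (Box.mk a)) (𝟙 (Box.mk c)) = 𝟙 (Box.mk (a + c)) := by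
  refine hom_ext fun x j => ?_
  change prodMap (OrderHom.id : Vert a →o Vert a) (OrderHom.id : Vert c →o Vert c) x j = x j
  simp only [prodMap_apply, OrderHom.id_coe, id]
  split_ifs
  · rfl
  · exact congrArg x (Fin.ext (by first | rfl | omega | (dsimp only; omega)))

theorem prod_comp {a b c a' b' c' : ℕ} (f : Box.mk a ⟶ Box.mk b) (g : Box.mk b ⟶ Box.mk c)
    (f' : Box.mk a' ⟶ Box.mk b') (g' : Box.mk b' ⟶ Box.mk c') :
    prod (f ≫ g) (f' ≫ g') = prod f f' ≫ prod g g' :=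
  Subtype.ext (prodMap_comp _ _ _ _)

end Box

/-! ### Cubical sets -/

/-- Cubical sets (with both connections): presheaves on the box category. -/
abbrev CSet : Type (u + 1) := Boxᵒᵖ ⥤ Type u

namespace CSet

/-- The set of `n`-cubes of `X`. -/
abbrev cubes (X : CSet.{u}) (n : ℕ) : Type u := X.obj (op (Box.mk n))

/-- The action of a box map on cubes, written on the right in the usual notation. -/
def act (X : CSet.{u}) {k n : ℕ} (x : X.cubes n) (p : Box.mk k ⟶ Box.mk n) : X.cubes k :=
  X.map p.op x

theorem act_id (X : CSet.{u}) {n : ℕ} (x : X.cubes n) : X.act x (𝟙 _) = x := by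
  simp [act]

theorem act_comp (X : CSet.{u}) {k l n : ℕ} (x : X.cubes n) (p : Box.mk l ⟶ Box.mk n)
    (q : Box.mk k ⟶ Box.mk l) : X.act x (q ≫ p) = X.act (X.act x p) q := by
  simp [act]

theorem map_act {X Y : CSet.{u}} (f : X ⟶ Y) {k n : ℕ} (x : X.cubes n)
    (p : Box.mk k ⟶ Box.mk n) : f.app _ (X.act x p) = Y.act (f.app _ x) p :=
  NatTrans.naturality_apply f p.op x

/-- The representable cubical set `□ⁿ`. -/
abbrev cube (n : ℕ) : CSet.{u} := uliftYoneda.{u}.obj (Box.mk n)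

/-- The map `□ᵐ → □ⁿ` given by a box map. -/
abbrev cubeMap {m n : ℕ} (p : Box.mk m ⟶ Box.mk n) : cube.{u} m ⟶ cube.{u} n :=
  uliftYoneda.{u}.map p

/-- The map `□ⁿ → X` given by an `n`-cube of `X`. -/
abbrev ofCube {X : CSet.{u}} {n : ℕ} (x : X.cubes n) : cube.{u} n ⟶ X :=
  uliftYonedaEquiv.{u}.symm x

/-- The `n`-cube of `X` given by a map `□ⁿ → X`. -/
abbrev toCube {X : CSet.{u}} {n : ℕ} (f : cube.{u} n ⟶ X) : X.cubes n :=
  uliftYonedaEquiv.{u} f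

end CSet

theorem isBoxMap_zero (k : ℕ) (f : Vert k →o Vert 0) : IsBoxMap f := by
  induction k with
  | zero => exact isBoxMap_of_cast rfl rfl (IsBoxMap.id 0) _ fun x j => j.elim0
  | succ k ih =>
    let g : Vert k →o Vert 0 := ⟨fun _ j => j.elim0, fun _ _ _ j => j.elim0⟩
    have := (ih g).comp (IsBoxMap.degen (0 : Fin (k + 1)))
    exact isBoxMap_of_cast rfl rfl this _ fun x j => j.elim0

/-- The unique map `[1]ᵏ → [1]⁰`. -/
def Box.toZero (b : Box) : b ⟶ Box.mk 0 :=
  ⟨⟨fun _ j => j.elim0, fun _ _ _ j => j.elim0⟩, isBoxMap_zero _ _⟩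

theorem Box.toZero_eq {b : Box} (f g : b ⟶ Box.mk 0) : f = g :=
  Box.hom_ext fun _ j => j.elim0

/-- The unique map `X → □⁰`. -/
def CSet.toPoint (X : CSet.{u}) : X ⟶ CSet.cube.{u} 0 where
  app b := ↾fun _ => ULift.up (Box.toZero b.unop)
  naturality _ _ _ := by
    ext x
    exact ULift.ext _ _ (Box.toZero_eq _ _)

theorem CSet.toPoint_eq {X : CSet.{u}} (f g : X ⟶ CSet.cube.{u} 0) : f = g := by
  ext b x
  exact ULift.ext _ _ (Box.toZero_eq _ _)

/-! ### The geometric product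

`X ⊗ Y` is the left Kan extension of `([1]ᵐ, [1]ⁿ) ↦ □ᵐ⁺ⁿ`, that is, the colimit of the `□ᵐ⁺ⁿ` over
all `x : □ᵐ → X`, `y : □ⁿ → Y`. Colimits being computed pointwise, a `k`-cube is a class of
triples `(x, y, h)` with `h : [1]ᵏ → [1]ᵐ⁺ⁿ`. -/

/-- Representatives of the `k`-cubes of `X ⊗ Y`. -/
structure TensorPre (X Y : CSet.{u}) (k : Box) : Type u where
  m : ℕ
  n : ℕ
  x : X.cubes m
  y : Y.cubes n
  h : k ⟶ Box.mk (m + n)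

/-- The identifications `(x p, y q, h) ∼ (x, y, (p ⊗ q) h)`. -/
inductive TensorRel (X Y : CSet.{u}) (k : Box) : TensorPre X Y k → TensorPre X Y k → Prop
  | mk {m n m' n' : ℕ} (x : X.cubes m) (y : Y.cubes n) (p : Box.mk m' ⟶ Box.mk m)
      (q : Box.mk n' ⟶ Box.mk n) (h : k ⟶ Box.mk (m' + n')) :
      TensorRel X Y k ⟨m', n', X.act x p, Y.act y q, h⟩ ⟨m, n, x, y, h ≫ Box.prod p q⟩

namespace CSet

/-- The geometric product `X ⊗ Y`. -/
def tensor (X Y : CSet.{u}) : CSet.{u} where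
  obj k := Quot (TensorRel X Y k.unop)
  map {k l} f := ↾Quot.map (fun t => ⟨t.m, t.n, t.x, t.y, f.unop ≫ t.h⟩) (by
    rintro _ _ ⟨x, y, p, q, h⟩
    have := TensorRel.mk x y p q (f.unop ≫ h)
    rwa [Category.assoc] at this)
  map_id k := by
    ext t
    induction t using Quot.ind with
    | mk t => simp [Quot.map]
  map_comp f g := by
    ext t
    induction t using Quot.ind with
    | mk t => simp [Quot.map]

/-- The cube of `X ⊗ Y` represented by `(x, y, h)`. -/
def tensorMk {X Y : CSet.{u}} {k : Box} {m n : ℕ} (x : X.cubes m) (y : Y.cubes n)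
    (h : k ⟶ Box.mk (m + n)) : (tensor X Y).obj (op k) :=
  Quot.mk _ ⟨m, n, x, y, h⟩

/-- Functoriality of the geometric product. -/
def tensorMap {X X' Y Y' : CSet.{u}} (f : X ⟶ X') (g : Y ⟶ Y') : tensor X Y ⟶ tensor X' Y' where
  app k := ↾Quot.map (fun t => ⟨t.m, t.n, f.app _ t.x, g.app _ t.y, t.h⟩) (by
    rintro _ _ ⟨x, y, p, q, h⟩
    have := TensorRel.mk (f.app _ x) (g.app _ y) p q h
    rwa [← map_act, ← map_act] at this)
  naturality k l p := by
    ext t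
    induction t using Quot.ind with
    | mk t => rfl

/-- The canonical map `□ᵐ⁺ⁿ → □ᵐ ⊗ □ⁿ` (an isomorphism). -/
def cubeToTensor (m n : ℕ) : cube.{u} (m + n) ⟶ tensor (cube.{u} m) (cube.{u} n) :=
  ofCube (tensorMk (ULift.up (𝟙 (Box.mk m))) (ULift.up (𝟙 (Box.mk n))) (𝟙 _))

/-- The canonical map `X → □⁰ ⊗ X` (an isomorphism). -/
def toPointTensor (X : CSet.{u}) : X ⟶ tensor (cube.{u} 0) X where
  app k := ↾fun x => tensorMk (n := k.unop.dim) (ULift.up (𝟙 (Box.mk 0))) x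
    (Box.cast (Nat.zero_add k.unop.dim).symm)
  naturality k l p := by
    ext x
    obtain ⟨⟨k⟩⟩ := k
    obtain ⟨⟨l⟩⟩ := l
    have h := Quot.sound (TensorRel.mk (X := cube.{u} 0) (Y := X) (k := Box.mk l)
      (ULift.up (𝟙 (Box.mk 0))) x (𝟙 _) p.unop (Box.cast (Nat.zero_add l).symm))
    refine h.trans (congrArg (fun e => Quot.mk _ (TensorPre.mk 0 k _ x e)) ?_)
    refine Box.hom_ext fun v j => ?_
    change (Box.prod (𝟙 (Box.mk 0)) p.unop).1 _ j = (Box.cast (Nat.zero_add k).symm).1 _ j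
    rw [Box.cast_val]
    change prodMap OrderHom.id p.unop.1 _ j = _
    simp only [prodMap_apply, Nat.not_lt_zero, dite_false]
    refine congrFun (congrArg p.unop.1 (funext fun i => ?_)) _
    rw [Box.cast_val]
    exact congrArg v (Fin.ext (by simp))

/-! ### Cones -/

/-- The map `∂_{1,1} ⊗ X : X → □¹ ⊗ X`, the inclusion of the end `{1} ⊗ X`. -/
def endIncl (X : CSet.{u}) : X ⟶ tensor (cube.{u} 1) X :=
  toPointTensor X ≫ tensorMap (cubeMap (Box.face 0 true)) (𝟙 X)

/-- The (left positive) cone `CX`: the pushout of `□⁰ ← X → □¹ ⊗ X`. -/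
noncomputable def cone (X : CSet.{u}) : CSet.{u} := pushout (toPoint X) (endIncl X)

/-- The standard cone `C^{m,n} = Cⁿ □ᵐ`. -/
noncomputable def stdCone (m : ℕ) : ℕ → CSet.{u}
  | 0 => cube m
  | n + 1 => cone (stdCone m n)

/-- The quotient map `□ᵐ⁺ⁿ → C^{m,n}`. Its first `n` coordinates are the cone coordinates, the one
of the outermost cone coming first:
`□ᵐ⁺ⁿ⁺¹ = □¹⁺⁽ᵐ⁺ⁿ⁾ → □¹ ⊗ □ᵐ⁺ⁿ → □¹ ⊗ C^{m,n} → C^{m,n+1}`. -/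
noncomputable def coneQuot (m : ℕ) : ∀ n : ℕ, cube.{u} (m + n) ⟶ stdCone.{u} m n
  | 0 => 𝟙 _
  | n + 1 => cubeMap (Box.cast (Nat.add_comm (m + n) 1)) ≫ cubeToTensor 1 (m + n) ≫
      tensorMap (𝟙 _) (coneQuot m n) ≫
      pushout.inr (toPoint (stdCone m n)) (endIncl (stdCone m n))

/-- An `(m,n)`-cone in `X`. -/
abbrev Cone (X : CSet.{u}) (m n : ℕ) : Type u := stdCone.{u} m n ⟶ X

/-- The cube `□ᴺ → C^{m,n} → X` underlying an `(m,n)`-cone in `X`, where `N = m + n`. -/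
noncomputable def Cone.cube {X : CSet.{u}} {m n : ℕ} (x : Cone X m n) (N : ℕ)
    (h : N = m + n := by omega) : X.cubes N :=
  X.act (toCube (coneQuot m n ≫ x)) (Box.cast h)

theorem epi_of_surjective {X Y : CSet.{u}} (f : X ⟶ Y) (h : ∀ k, Function.Surjective (f.app k)) :
    Epi f := by
  have : ∀ k, Epi (f.app k) := fun k => (epi_iff_surjective _).2 (h k)
  exact NatTrans.epi_of_epi_app f

theorem surjective_of_epi {X Y : CSet.{u}} (f : X ⟶ Y) [Epi f] (k : Boxᵒᵖ) :
    Function.Surjective (f.app k) :=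
  (epi_iff_surjective _).1 inferInstance

instance epi_cubeToTensor (m n : ℕ) : Epi (cubeToTensor.{u} m n) := by
  refine epi_of_surjective _ fun k t => ?_
  induction t using Quot.ind with
  | mk t =>
    obtain ⟨a, b, ⟨p⟩, ⟨q⟩, h⟩ := t
    refine ⟨ULift.up (h ≫ Box.prod p q), ?_⟩
    have := Quot.sound (TensorRel.mk (X := cube.{u} m) (Y := cube.{u} n)
      (ULift.up (𝟙 (Box.mk m))) (ULift.up (𝟙 (Box.mk n))) p q h)
    have hp : (cube.{u} m).act (ULift.up (𝟙 (Box.mk m))) p = ULift.up p :=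
      congrArg ULift.up (Category.comp_id p)
    have hq : (cube.{u} n).act (ULift.up (𝟙 (Box.mk n))) q = ULift.up q :=
      congrArg ULift.up (Category.comp_id q)
    rw [hp, hq] at this
    refine Eq.trans ?_ this.symm
    exact congrArg (fun e => Quot.mk _ (TensorPre.mk m n _ _ e)) (Category.comp_id _)

theorem epi_tensorMap (X : CSet.{u}) {Y Z : CSet.{u}} (g : Y ⟶ Z) [Epi g] :
    Epi (tensorMap (𝟙 X) g) := by
  refine epi_of_surjective _ fun k t => ?_
  induction t using Quot.ind with
  | mk t =>
    obtain ⟨a, b, x, y, h⟩ := t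
    obtain ⟨z, rfl⟩ := surjective_of_epi g _ y
    exact ⟨Quot.mk _ ⟨a, b, x, z, h⟩, rfl⟩

theorem epi_toPoint {X : CSet.{u}} (x : X.cubes 0) : Epi (toPoint X) :=
  epi_of_surjective _ fun k _ =>
    ⟨X.map (Box.toZero k.unop).op x, ULift.ext _ _ (Box.toZero_eq _ _)⟩

theorem nonempty_stdCone (m n : ℕ) : Nonempty ((stdCone.{u} m n).cubes 0) := by
  have h : ∀ N : ℕ, Nonempty (Box.mk 0 ⟶ Box.mk N) := fun N => by
    induction N with
    | zero => exact ⟨𝟙 _⟩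
    | succ N ih => exact ih.map fun p => p ≫ Box.face 0 false
  exact (h (m + n)).map fun p => (coneQuot m n).app _ (ULift.up p)

/-- The quotient map `□ᵐ⁺ⁿ → C^{m,n}` is an epimorphism. -/
instance epi_coneQuot (m n : ℕ) : Epi (coneQuot.{u} m n) := by
  induction n with
  | zero => exact inferInstanceAs (Epi (𝟙 _))
  | succ n ih =>
    have := epi_toPoint (nonempty_stdCone.{u} m n).some
    have := epi_tensorMap (cube.{u} 1) (coneQuot.{u} m n)
    have : IsIso (Box.cast (Nat.add_comm (m + n) 1)) := by
      unfold Box.cast; infer_instance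
    have h₁ : Epi (cubeMap.{u} (Box.cast (Nat.add_comm (m + n) 1))) := by
      unfold cubeMap; infer_instance
    have h₂ : Epi (pushout.inr (toPoint (stdCone.{u} m n)) (endIncl (stdCone m n))) :=
      inferInstance
    exact epi_comp' h₁ (epi_comp' (epi_cubeToTensor _ _) (epi_comp' inferInstance h₂))

/-- A cone is determined by its underlying cube. -/
theorem Cone.cube_injective {X : CSet.{u}} {m n : ℕ} {x y : Cone X m n} (N : ℕ) (h : N = m + n)
    (hxy : x.cube N h = y.cube N h) : x = y := by
  subst h
  have e : ∀ z : Cone X m n, z.cube (m + n) rfl = toCube (coneQuot m n ≫ z) := fun z =>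
    act_id X _
  rw [e, e] at hxy
  exact (cancel_epi (coneQuot m n)).1 (uliftYonedaEquiv.{u}.injective hxy)

/-! ### Open boxes and cubical quasicategories -/

/-- The open box `⊓_{i,ε}` in `□ᴺ⁺¹`: the union of all faces except `∂_{i,ε}`. -/
def openBox (N : ℕ) (i : Fin (N + 1)) (ε : Bool) : Subfunctor (cube.{u} (N + 1)) :=
  ⨆ (j : Fin (N + 1)) (δ : Bool) (_ : (j, δ) ≠ (i, ε)),
    Subfunctor.range (cubeMap.{u} (Box.face j δ))

end CSet

/-- The map `[1] → [1]ᴺ⁺¹` with `i`-th coordinate the identity and all others constant `1 - ε`. -/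
def critMap (N : ℕ) (i : Fin (N + 1)) (ε : Bool) : Vert 1 →o Vert (N + 1) where
  toFun x j := if j = i then x 0 else !ε
  monotone' x y hxy j := by
    dsimp only
    split_ifs
    · exact hxy _
    · exact le_rfl

theorem critMap_apply (N : ℕ) (i : Fin (N + 1)) (ε : Bool) (x : Vert 1) (j : Fin (N + 1)) :
    critMap N i ε x j = if j = i then x 0 else !ε := rfl

theorem critMap_eq_face_comp (N : ℕ) (i j : Fin (N + 2)) (hij : j ≠ i) (ε : Bool) :
    ∃ i', critMap (N + 1) i ε = (faceMap j (!ε)).comp (critMap N i' ε) := by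
  have hij' : j.1 ≠ i.1 := fun h => hij (Fin.ext h)
  refine ⟨⟨if i.1 < j.1 then i.1 else i.1 - 1, by
    have := i.2; have := j.2; split_ifs <;> omega⟩, ?_⟩
  ext x l
  simp only [critMap_apply, faceMap_apply, OrderHom.comp_coe, Function.comp_apply, Fin.ext_iff]
  by_cases h : i.1 < j.1
  · simp only [h, if_true]
    split_ifs <;> first | rfl | omega
  · simp only [h, if_false]
    split_ifs <;> first | rfl | omega

theorem isBoxMap_critMap (N : ℕ) (i : Fin (N + 1)) (ε : Bool) : IsBoxMap (critMap N i ε) := by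
  induction N with
  | zero =>
    refine isBoxMap_of_cast rfl rfl (IsBoxMap.id 1) _ fun x j => ?_
    have hi : j = i := Subsingleton.elim _ _
    change (if j = i then x 0 else !ε) = x _
    rw [if_pos hi]
    exact congrArg x (Subsingleton.elim _ _)
  | succ N ih =>
    obtain ⟨j, hj⟩ := exists_ne i
    obtain ⟨i', h⟩ := critMap_eq_face_comp N i j hj ε
    rw [h]
    exact (IsBoxMap.face _ _).comp (ih i')

namespace CSet

/-- The critical edge of `□ᴺ⁺¹` with respect to the face `∂_{i,ε}`. -/
def critEdge (N : ℕ) (i : Fin (N + 1)) (ε : Bool) : cube.{u} 1 ⟶ cube.{u} (N + 1) :=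
  cubeMap ⟨critMap N i ε, isBoxMap_critMap N i ε⟩

theorem critEdge_mem (N : ℕ) (i : Fin (N + 2)) (ε : Bool) :
    Subfunctor.range (critEdge.{u} (N + 1) i ε) ≤ openBox (N + 1) i ε := by
  obtain ⟨j, hj⟩ := exists_ne i
  obtain ⟨i', h⟩ := critMap_eq_face_comp N i j hj ε
  have hne : (j, !ε) ≠ (i, ε) := fun h => hj (congrArg Prod.fst h)
  refine le_trans ?_ (le_iSup_of_le j (le_iSup_of_le (!ε) (le_iSup_of_le hne le_rfl)))
  have : critEdge.{u} (N + 1) i ε = critEdge N i' ε ≫ cubeMap (Box.face j (!ε)) := by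
    rw [critEdge, critEdge, cubeMap, cubeMap, ← Functor.map_comp]
    exact congrArg _ (Subtype.ext h)
  rw [this]
  exact Subfunctor.range_comp_le _ _

/-- The critical edge as an edge of the open box (in dimension at least two). -/
def critEdgeBox (N : ℕ) (i : Fin (N + 2)) (ε : Bool) :
    cube.{u} 1 ⟶ (openBox.{u} (N + 1) i ε).toFunctor :=
  Subfunctor.lift (critEdge (N + 1) i ε) (critEdge_mem N i ε)

/-- The inner open box: the open box in `□ᴺ⁺²` with its critical edge collapsed to a point. -/
noncomputable def innerOpenBox (N : ℕ) (i : Fin (N + 2)) (ε : Bool) : CSet.{u} :=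
  pushout (toPoint (cube 1)) (critEdgeBox N i ε)

/-- The inner cube: `□ᴺ⁺²` with the critical edge collapsed to a point. -/
noncomputable def innerCube (N : ℕ) (i : Fin (N + 2)) (ε : Bool) : CSet.{u} :=
  pushout (toPoint (cube 1)) (critEdge (N + 1) i ε)

/-- The inner open box inclusion. -/
noncomputable def innerOpenBoxIncl (N : ℕ) (i : Fin (N + 2)) (ε : Bool) :
    innerOpenBox.{u} N i ε ⟶ innerCube.{u} N i ε :=
  pushout.map _ _ _ _ (𝟙 _) (openBox (N + 1) i ε).ι (𝟙 _) (by simp) (by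
    rw [Category.id_comp]
    exact Subfunctor.lift_ι _ _)

/-- Inner fibrations: the right lifting property against all inner open box inclusions (in all
dimensions at least two). -/
def IsInnerFibration {X Y : CSet.{u}} (f : X ⟶ Y) : Prop :=
  ∀ (N : ℕ) (i : Fin (N + 2)) (ε : Bool), HasLiftingProperty (innerOpenBoxIncl.{u} N i ε) f

/-- `X` is a cubical quasicategory if `X → □⁰` is an inner fibration. -/
def IsQuasicategory (X : CSet.{u}) : Prop := IsInnerFibration (toPoint X)

/-! ### Coherent families of composites -/

/-- The family `θ^{m,n}` is a coherent family of composites. An expression such as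
`θ^{m,n}(x ∂_{i,0})` refers to the cone with underlying cube `x ∂_{i,0}`; it is unique by
`Cone.cube_injective`, and its existence is made part of each identity. Indices of operators
start from `0`, and `m`, `n` are shifted where necessary so that no subtraction occurs. -/
structure IsCoherentFamily (X : CSet.{u}) (θ : ∀ m n : ℕ, Cone X m n → Cone X m (n + 1)) :
    Prop where
  /-- `θ^{m,n}(x) ∂_{i,0} = θ^{m,n-1}(x ∂_{i,0})` for `i` among the first `n` indices. -/
  face_zero : ∀ (m n : ℕ) (x : Cone X m (n + 1)) (i : ℕ) (hi : i < n + 1),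
    ∃ y : Cone X m n,
      y.cube (m + n) = X.act (x.cube (m + n + 1)) (Box.face ⟨i, by omega⟩ false) ∧
      X.act ((θ m (n + 1) x).cube (m + n + 2)) (Box.face ⟨i, by omega⟩ false) =
        (θ m n y).cube (m + n + 1)
  /-- `θ^{m,n}(x) ∂_{n+1,0} = x` (with indices starting from `1`). -/
  face_zero_self : ∀ (m n : ℕ) (x : Cone X m n),
    X.act ((θ m n x).cube (m + n + 1)) (Box.face ⟨n, by omega⟩ false) = x.cube (m + n)
  /-- `θ^{m,n}(x) ∂_{i+1,1} = θ^{m-1,n}(x ∂_{i,1})` for `i` beyond the first `n` indices. -/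
  face_one : ∀ (m n : ℕ) (x : Cone X (m + 1) n) (i : ℕ) (hi : i < m + n + 1), n ≤ i →
    ∃ y : Cone X m n,
      y.cube (m + n) = X.act (x.cube (m + n + 1)) (Box.face ⟨i, hi⟩ true) ∧
      X.act ((θ (m + 1) n x).cube (m + n + 2)) (Box.face ⟨i + 1, by omega⟩ true) =
        (θ m n y).cube (m + n + 1)
  /-- `θ^{m,n}(x σ_i) = θ^{m-1,n}(x) σ_{i+1}` for `i` beyond the first `n` indices. -/
  degen : ∀ (m n : ℕ) (x : Cone X m n) (i : ℕ) (hi : i < m + n + 1), n ≤ i →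
    ∃ y : Cone X (m + 1) n,
      y.cube (m + n + 1) = X.act (x.cube (m + n)) (Box.degen ⟨i, hi⟩) ∧
      (θ (m + 1) n y).cube (m + n + 2) =
        X.act ((θ m n x).cube (m + n + 1)) (Box.degen ⟨i + 1, by omega⟩)
  /-- `θ^{m,n}(x γ_{i,0}) = θ^{m,n-1}(x) γ_{i,0}` for `i` among the first `n - 1` indices. -/
  conn_low : ∀ (m n : ℕ) (x : Cone X m n) (i : ℕ) (hi : i < n),
    ∃ y : Cone X m (n + 1),
      y.cube (m + n + 1) = X.act (x.cube (m + n)) (Box.conn ⟨i, by omega⟩ false) ∧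
      (θ m (n + 1) y).cube (m + n + 2) =
        X.act ((θ m n x).cube (m + n + 1)) (Box.conn ⟨i, by omega⟩ false)
  /-- `θ^{m,n}(x γ_{i,ε}) = θ^{m-1,n}(x) γ_{i+1,ε}` for `i` beyond the first `n` indices. -/
  conn_high : ∀ (m n : ℕ) (x : Cone X m n) (i : ℕ) (hi : i < m + n) (ε : Bool), n ≤ i →
    ∃ y : Cone X (m + 1) n,
      y.cube (m + n + 1) = X.act (x.cube (m + n)) (Box.conn ⟨i, hi⟩ ε) ∧
      (θ (m + 1) n y).cube (m + n + 2) =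
        X.act ((θ m n x).cube (m + n + 1)) (Box.conn ⟨i + 1, by omega⟩ ε)
  /-- `θ^{m,n}(θ^{m,n-1}(x)) = θ^{m,n-1}(x) γ_{n,0}` (with indices starting from `1`). -/
  theta_theta : ∀ (m n : ℕ) (x : Cone X m n),
    (θ m (n + 1) (θ m n x)).cube (m + n + 2) =
      X.act ((θ m n x).cube (m + n + 1)) (Box.conn ⟨n, by omega⟩ false)
  /-- If the `(m,n)`-cone `y` is the cone given by an `(m-1,n+1)`-cone `x`, then
  `θ^{m,n}(y) = x γ_{n+1,0}` (with indices starting from `1`). -/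
  cone_wlog : ∀ (m n : ℕ) (x : Cone X m (n + 1)),
    ∃ y : Cone X (m + 1) n,
      y.cube (m + n + 1) = x.cube (m + n + 1) ∧
      (θ (m + 1) n y).cube (m + n + 2) =
        X.act (x.cube (m + n + 1)) (Box.conn ⟨n, by omega⟩ false)

end CSet

end Cubical

/-! A cone is handled through its underlying cube: `IsCone n x` says that once a coordinate `i < n`
is 1, the coordinates after `i` no longer matter. Then θ sends an `n`-cone `x` of dimension `N` to a
cube `z` of dimension `N + 1`, with a new coordinate at position `n` (counted from 0) and `x` at its
end 0. The identities split into conditions on `z` and `x` alone (`BaseAt`) and conditions that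
refer to θ one dimension lower (`RelAt`), so θ can be chosen cube by cube, by recursion on the
dimension (`exists_theta`).

If `x` is an `(n+1)`-cone, a value of θ, degenerate in the coordinates from `n` on, or a low
connection of a cone, then one of the identities dictates `z`. The point is that the remaining
identities hold for it and that it does not depend on how `x` is presented. Overlaps involving the
first two cases are settled in `relAt_conn` and `relAt_self`. Overlaps among degeneracies rest on
`exists_common_degeneracy`: two presentations of a degenerate cube have a common refinement, apart
from an exceptional situation in which their bases coincide. This yields `hi_unique`, `lo_hi_unique`
and `lo_unique`.

In the remaining case only faces of `z` are prescribed: all those at 1, and those at 0 in directions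
up to `n`. They are compatible (`thetaBoundary_compatible`). The free faces at 0 are supplied by
successive open box fillings (`exists_filler_of_partial`). Each box lacks a face at 0 in a direction
other than the first, so its critical edge lies in the face where the first coordinate is 1. That
face is constant by the cone condition, so the box is inner and has a filler.

Finally `isCone_toCube` and `exists_cone_of_isCone` identify `n`-cones in the sense of `IsCone` with
maps out of the standard cones, through the correspondence between maps out of `□¹ ⊗ Y` and maps
from `Y` to a path object. -/

namespace Cubical

/-! ### Box operators in coordinates -/

/-- The `j`-th coordinate of a vertex, with value `0` out of range. -/
def coord {n : ℕ} (x : Vert n) (j : ℕ) : Bool := if h : j < n then x ⟨j, h⟩ else false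

/-- The shapes of degeneracies: `σ` and the two connections. -/
inductive Shape : Type
  | degen : Shape
  | conn (ε : Bool) : Shape

/-- The number of coordinates that a degeneracy operator of a given shape reads. -/
def Shape.width : Shape → ℕ
  | degen => 1
  | conn _ => 2

/-- The effect of a degeneracy operator on its two leading coordinates. -/
def Shape.op : Shape → Bool → Bool → Bool
  | degen, _, b => b
  | conn true, a, b => a && b
  | conn false, a, b => a || b

@[simp] theorem Shape.op_degen (a b : Bool) : Shape.degen.op a b = b := rfl
@[simp] theorem Shape.op_conn_true (a b : Bool) : (Shape.conn true).op a b = (a && b) := rfl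
@[simp] theorem Shape.op_conn_false (a b : Bool) : (Shape.conn false).op a b = (a || b) := rfl
@[simp] theorem Shape.op_self (τ : Shape) (a : Bool) : τ.op a a = a := by
  rcases τ with _ | _ | _ <;> simp
@[simp] theorem Shape.width_degen : Shape.degen.width = 1 := rfl
@[simp] theorem Shape.width_conn (ε : Bool) : (Shape.conn ε).width = 2 := rfl

namespace Box

/-- The map on vertices underlying a box map. -/
def app {a b : ℕ} (f : Box.mk a ⟶ Box.mk b) (x : Vert a) : Vert b := f.1 x

/-- Out-of-range coordinates are `false` on both sides, so `j` may be any natural number and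
operator identities become case distinctions on `j`. -/
theorem hom_ext_coord {a b : ℕ} {f g : Box.mk a ⟶ Box.mk b}
    (h : ∀ x : Vert a, ∀ j, coord (Box.app f x) j = coord (Box.app g x) j) : f = g := by
  refine hom_ext fun x j => ?_
  have := h x j.1
  have hj : j.1 < b := j.2
  simpa [coord, hj, app] using this

theorem coord_comp {a b c : ℕ} (f : Box.mk a ⟶ Box.mk b) (g : Box.mk b ⟶ Box.mk c)
    (x : Vert a) (j : ℕ) : coord (app (f ≫ g) x) j = coord (Box.app g (Box.app f x)) j := rfl

/-- The face operator with a natural number as index. -/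
def faceN {n : ℕ} (i : ℕ) (ε : Bool) : Box.mk n ⟶ Box.mk (n + 1) :=
  face ⟨min i n, by omega⟩ ε

/-- The degeneracy operator of a given shape with a natural number as index; a connection whose
index is that of the last coordinate is understood as a degeneracy. -/
def degN {n : ℕ} (τ : Shape) (i : ℕ) : Box.mk (n + 1) ⟶ Box.mk n :=
  match τ with
  | .degen => degen ⟨min i n, by omega⟩
  | .conn ε => if h : i < n then conn ⟨i, h⟩ ε else degen ⟨min i n, by omega⟩

theorem faceN_eq {n : ℕ} {i : ℕ} (hi : i < n + 1) (ε : Bool) :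
    faceN (n := n) i ε = face ⟨i, hi⟩ ε := by
  unfold faceN
  congr 2
  omega

theorem degN_degen_eq {n : ℕ} {i : ℕ} (hi : i < n + 1) :
    degN (n := n) .degen i = degen ⟨i, hi⟩ := by
  unfold degN
  dsimp only
  congr 2
  omega

theorem degN_conn_eq {n : ℕ} {i : ℕ} (hi : i < n) (ε : Bool) :
    degN (n := n) (.conn ε) i = conn ⟨i, hi⟩ ε := by
  unfold degN
  simp [hi]

theorem coord_faceN {n i : ℕ} (hi : i ≤ n) (ε : Bool) (x : Vert n) (j : ℕ) :
    coord (app (faceN i ε) x) j =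
      if j < i then coord x j else if j = i then ε else coord x (j - 1) := by
  rw [faceN_eq (by omega)]
  change coord (faceMap ⟨i, _⟩ ε x) j = _
  unfold coord
  simp only [faceMap_apply]
  split_ifs <;> first | rfl | omega

theorem coord_degN {n i : ℕ} (τ : Shape) (hi : i ≤ n) (x : Vert (n + 1)) (j : ℕ) :
    coord (app (degN τ i) x) j =
      if j < i then coord x j
      else if j = i ∧ i < n then τ.op (coord x i) (coord x (i + 1)) else coord x (j + 1) := by
  have key : coord (app (b := n) (degen (n := n) ⟨i, by omega⟩) x) j =
      if j < i then coord x j else coord x (j + 1) := by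
    change coord (degenMap ⟨i, _⟩ x) j = _
    unfold coord
    simp only [degenMap_apply]
    split_ifs <;> first | rfl | omega
  rcases τ with _ | ε
  · rw [degN_degen_eq (by omega), key]
    split_ifs <;> first | rfl | simp_all
  · by_cases h : i < n
    · rw [degN_conn_eq h]
      change coord (connMap ⟨i, _⟩ ε x) j = _
      have h1 : coord x i = x ⟨i, by omega⟩ := by
        simp [coord, show i < n + 1 by omega]
      have h2 : coord x (i + 1) = x ⟨i + 1, by omega⟩ := by simp [coord, h]
      rw [h1, h2]
      unfold coord
      simp only [connMap_apply]
      cases ε <;> split_ifs <;> first | rfl | omega | simp_all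
    · have : degN (n := n) (.conn ε) i = degen ⟨i, by omega⟩ := by
        unfold degN
        simp only [h, dite_false]
        congr 2
        omega
      rw [this, key]
      split_ifs <;> first | rfl | omega

/-- The map of posets setting the coordinates satisfying a predicate to `1`. -/
def raiseMap (n : ℕ) (p : ℕ → Bool) : Vert n →o Vert n where
  toFun x j := if p j.1 then true else x j
  monotone' x y hxy j := by
    dsimp only
    split_ifs
    · exact le_rfl
    · exact hxy _

/-- Raising one coordinate means deleting it and inserting 1, a degeneracy followed by a face. The
bound `k` lets the coordinates be raised one at a time. -/
theorem isBoxMap_raiseMap_aux (n : ℕ) (p : ℕ → Bool) (k : ℕ) :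
    IsBoxMap (raiseMap n fun j => p j && decide (j < k)) := by
  induction k with
  | zero =>
    have : raiseMap n (fun j => p j && decide (j < 0)) = OrderHom.id :=
      OrderHom.ext _ _ (funext fun x => funext fun j => by simp [raiseMap])
    rw [this]
    exact IsBoxMap.id n
  | succ k ih =>
    by_cases hk : k < n ∧ p k = true
    · obtain ⟨hk, hp⟩ := hk
      obtain ⟨n, rfl⟩ : ∃ l, n = l + 1 := ⟨n - 1, by omega⟩
      have : raiseMap (n + 1) (fun j => p j && decide (j < k + 1)) =
          (((faceMap ⟨k, hk⟩ true).comp (degenMap ⟨k, hk⟩)).comp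
            (raiseMap (n + 1) fun j => p j && decide (j < k))) := by
        refine OrderHom.ext _ _ (funext fun x => funext fun j => ?_)
        simp only [OrderHom.comp_coe, Function.comp_apply, faceMap_apply, degenMap_apply]
        simp only [raiseMap]
        have hj := j.2
        rcases lt_trichotomy j.1 k with h | h | h
        · simp [h, h.le]
        · simp [h, hp]
        · have h1 : ¬ j.1 < k := by omega
          have h2 : ¬ j.1 < k + 1 := by omega
          have h3 : ¬ j.1 = k := by omega
          have h4 : ¬ j.1 - 1 < k := by omega
          have h5 : j.1 - 1 + 1 = j.1 := by omega
          simp [h1, h3, h4, h5, Nat.not_le.2 h]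
      rw [this]
      exact ((IsBoxMap.face _ _).comp (IsBoxMap.degen _)).comp ih
    · have : raiseMap n (fun j => p j && decide (j < k + 1)) =
          raiseMap n fun j => p j && decide (j < k) := by
        refine OrderHom.ext _ _ (funext fun x => funext fun j => ?_)
        simp only [raiseMap]
        have hj := j.2
        by_cases h : j.1 = k
        · have : p k = false := by
            have : ¬ p k = true := fun h' => hk ⟨by omega, h'⟩
            simpa using this
          simp [h, this]
        · have : j.1 ≤ k ↔ j.1 < k := by omega
          simp [this]
      rw [this]
      exact ih

/-- Setting the coordinates satisfying a predicate to `1`, as a morphism of the box category. -/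
def raise {n : ℕ} (p : ℕ → Bool) : Box.mk n ⟶ Box.mk n :=
  ⟨raiseMap n p, by
    have := isBoxMap_raiseMap_aux n p n
    have h : (raiseMap n fun j => p j && decide (j < n)) = raiseMap n p :=
      OrderHom.ext _ _ (funext fun x => funext fun j => by simp [raiseMap])
    rwa [h] at this⟩

theorem coord_raise {n : ℕ} (p : ℕ → Bool) (x : Vert n) (j : ℕ) :
    coord (app (raise p) x) j = if j < n ∧ p j then true else coord x j := by
  change coord (raiseMap n p x) j = _
  unfold coord
  simp only [raiseMap]
  split_ifs <;> first | rfl | simp_all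

theorem coord_of_le {n : ℕ} (x : Vert n) {j : ℕ} (h : n ≤ j) : coord x j = false := by
  simp [coord, Nat.not_lt.2 h]

end Box

/-! ### Cubical identities for faces, degeneracies and caps -/

namespace CSet

variable {X : CSet.{u}} {N : ℕ}

/-- The face `x ∂_{i,ε}` of a cube. -/
def d (i : ℕ) (ε : Bool) (x : X.cubes (N + 1)) : X.cubes N := X.act x (Box.faceN i ε)

/-- The degenerate cube `x σ_i` or `x γ_{i,ε}`. -/
def e (τ : Shape) (i : ℕ) (x : X.cubes N) : X.cubes (N + 1) := X.act x (Box.degN τ i)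

/-- The cube obtained by setting the coordinate `i` to `1`. -/
def top (i : ℕ) (x : X.cubes N) : X.cubes N := X.act x (Box.raise fun j => decide (j = i))

/-- The cube obtained by setting the coordinates from `i` onwards to `1`. -/
def cap (i : ℕ) (x : X.cubes N) : X.cubes N := X.act x (Box.raise fun j => decide (i ≤ j))

theorem act_congr {k l l' n : ℕ} {x : X.cubes n} {p : Box.mk l ⟶ Box.mk n}
    {q : Box.mk k ⟶ Box.mk l} {p' : Box.mk l' ⟶ Box.mk n} {q' : Box.mk k ⟶ Box.mk l'}
    (h : ∀ v j, coord (Box.app p (Box.app q v)) j = coord (Box.app p' (Box.app q' v)) j) :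
    X.act (X.act x p) q = X.act (X.act x p') q' := by
  rw [← act_comp, ← act_comp]
  exact congrArg _ (Box.hom_ext_coord h)

theorem act_congr_left {k l n : ℕ} {x : X.cubes n} {p : Box.mk l ⟶ Box.mk n}
    {q : Box.mk k ⟶ Box.mk l} {p' : Box.mk k ⟶ Box.mk n}
    (h : ∀ v j, coord (Box.app p (Box.app q v)) j = coord (Box.app p' v) j) :
    X.act (X.act x p) q = X.act x p' := by
  rw [← act_comp]
  exact congrArg _ (Box.hom_ext_coord h)

theorem act_eq_self {k n : ℕ} {x : X.cubes n} {p : Box.mk k ⟶ Box.mk n}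
    {q : Box.mk n ⟶ Box.mk k}
    (h : ∀ v j, coord (Box.app p (Box.app q v)) j = coord v j) :
    X.act (X.act x p) q = x := by
  have : q ≫ p = 𝟙 _ := Box.hom_ext_coord h
  rw [← act_comp, this, act_id]

theorem d_d {i j : ℕ} (h : i ≤ j) (hj : j ≤ N) (ε ε' : Bool) (x : X.cubes (N + 2)) :
    d i ε (d (j + 1) ε' x) = d j ε' (d i ε x) := by
  refine act_congr fun v l => ?_
  simp (disch := omega) only [Box.coord_faceN]
  grind

theorem d_e_of_lt {i j : ℕ} (h : j ≤ i) (hi : i ≤ N) (ε : Bool) (τ : Shape)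
    (x : X.cubes (N + 1)) : d j ε (e τ (i + 1) x) = e τ i (d j ε x) := by
  refine act_congr fun v l => ?_
  simp (disch := omega) only [Box.coord_faceN, Box.coord_degN]
  grind

theorem d_e_of_gt {i j : ℕ} (τ : Shape) (h : i + τ.width ≤ j + 1) (hj : j ≤ N) (ε : Bool)
    (x : X.cubes (N + 1)) : d (j + 1) ε (e τ i x) = e τ i (d j ε x) := by
  have hw : 1 ≤ τ.width := by rcases τ with _ | _ <;> simp
  refine act_congr fun v l => ?_
  simp (disch := omega) only [Box.coord_faceN, Box.coord_degN]
  rcases τ with _ | ε <;> simp at h <;> grind [Shape.op_degen]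

theorem d_degen_self {i : ℕ} (hi : i ≤ N) (ε : Bool) (x : X.cubes N) :
    d i ε (e .degen i x) = x := by
  refine act_eq_self fun v l => ?_
  simp (disch := omega) only [Box.coord_faceN, Box.coord_degN, Shape.op_degen]
  grind

theorem d_conn_self {i : ℕ} (hi : i ≤ N) (ε : Bool) (x : X.cubes N) :
    d i ε (e (.conn ε) i x) = x := by
  refine act_eq_self fun v l => ?_
  simp (disch := omega) only [Box.coord_faceN, Box.coord_degN]
  cases ε <;> simp only [Shape.op_conn_true, Shape.op_conn_false] <;> grind

theorem d_conn_succ {i : ℕ} (hi : i < N) (ε : Bool) (x : X.cubes N) :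
    d (i + 1) ε (e (.conn ε) i x) = x := by
  refine act_eq_self fun v l => ?_
  simp (disch := omega) only [Box.coord_faceN, Box.coord_degN]
  cases ε <;> simp only [Shape.op_conn_true, Shape.op_conn_false] <;> grind

theorem d_conn_not {i : ℕ} (hi : i ≤ N) (ε : Bool) (x : X.cubes (N + 1)) :
    d i (!ε) (e (.conn ε) i x) = e .degen i (d i (!ε) x) := by
  refine act_congr fun v l => ?_
  simp (disch := omega) only [Box.coord_faceN, Box.coord_degN]
  cases ε <;> simp only [Shape.op_conn_true, Shape.op_conn_false, Shape.op_degen] <;> grind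

theorem d_conn_not_succ {i : ℕ} (hi : i ≤ N) (ε : Bool) (x : X.cubes (N + 1)) :
    d (i + 1) (!ε) (e (.conn ε) i x) = e .degen i (d i (!ε) x) := by
  refine act_congr fun v l => ?_
  simp (disch := omega) only [Box.coord_faceN, Box.coord_degN]
  cases ε <;> simp only [Shape.op_conn_true, Shape.op_conn_false, Shape.op_degen] <;> grind

theorem d_true_conn {i : ℕ} (hi : i ≤ N) (x : X.cubes (N + 1)) :
    d i true (e (.conn false) i x) = e .degen i (d i true x) := d_conn_not hi false x

theorem d_true_conn_succ {i : ℕ} (hi : i ≤ N) (x : X.cubes (N + 1)) :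
    d (i + 1) true (e (.conn false) i x) = e .degen i (d i true x) := d_conn_not_succ hi false x

theorem e_e {i k : ℕ} (τ τ' : Shape) (h : i + τ.width ≤ k + 1) (hk : k ≤ N) (x : X.cubes N) :
    e τ i (e τ' k x) = e τ' (k + 1) (e τ i x) := by
  have hw : 1 ≤ τ.width := by rcases τ with _ | _ <;> simp
  refine act_congr fun v l => ?_
  simp (disch := omega) only [Box.coord_degN]
  rcases τ with _ | ε <;> simp at h <;> grind [Shape.op_degen]

theorem conn_conn {i : ℕ} (ε : Bool) (hi : i ≤ N) (x : X.cubes N) :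
    e (.conn ε) i (e (.conn ε) i x) = e (.conn ε) (i + 1) (e (.conn ε) i x) := by
  refine act_congr fun v l => ?_
  simp (disch := omega) only [Box.coord_degN]
  cases ε <;> simp only [Shape.op_conn_true, Shape.op_conn_false] <;> grind

theorem conn_degen {i : ℕ} (ε : Bool) (hi : i ≤ N) (x : X.cubes N) :
    e (.conn ε) i (e .degen i x) = e .degen i (e .degen i x) := by
  refine act_congr fun v l => ?_
  simp (disch := omega) only [Box.coord_degN]
  cases ε <;> simp only [Shape.op_conn_true, Shape.op_conn_false, Shape.op_degen] <;> grind

theorem exists_d_e (τ : Shape) {i : ℕ} (hi : i ≤ N) :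
    ∃ ε, ∀ x : X.cubes N, d i ε (e τ i x) = x := by
  rcases τ with _ | ε
  · exact ⟨true, d_degen_self hi true⟩
  · exact ⟨ε, d_conn_self hi ε⟩

theorem e_injective (τ : Shape) {i : ℕ} (hi : i ≤ N) {x y : X.cubes N}
    (h : e τ i x = e τ i y) : x = y := by
  obtain ⟨ε, hε⟩ := exists_d_e (X := X) τ hi
  rw [← hε x, h, hε]

theorem cap_cap (i j : ℕ) (x : X.cubes N) : cap i (cap j x) = cap (min i j) x := by
  refine act_congr_left fun v l => ?_
  simp only [Box.coord_raise, decide_eq_true_eq]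
  grind

theorem cap_of_le {i : ℕ} (h : N ≤ i) (x : X.cubes N) : cap i x = x := by
  have : (Box.raise fun j => decide (i ≤ j) : Box.mk N ⟶ Box.mk N) = 𝟙 _ := by
    refine Box.hom_ext_coord fun v l => ?_
    simp only [Box.coord_raise, decide_eq_true_eq]
    rw [if_neg (by omega)]
    rfl
  rw [cap, this, act_id]

theorem d_cap_of_le {i j : ℕ} (h : j ≤ i) (hj : j ≤ N) (ε : Bool) (x : X.cubes (N + 1)) :
    d j ε (cap (i + 1) x) = cap i (d j ε x) := by
  refine act_congr fun v l => ?_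
  simp (disch := omega) only [Box.coord_faceN, Box.coord_raise, decide_eq_true_eq]
  have := Box.coord_of_le v (j := l - 1)
  grind

/-- After `cap i` nothing depends on the coordinates from `i` on, so all faces in these directions,
at either end, agree. -/
theorem d_cap_of_ge {i j k : ℕ} (hij : i ≤ j) (hik : i ≤ k) (hj : j ≤ N) (hk : k ≤ N) (ε : Bool)
    (x : X.cubes (N + 1)) : d j ε (cap i x) = cap i (d k true x) := by
  refine act_congr fun v l => ?_
  simp (disch := omega) only [Box.coord_faceN, Box.coord_raise, decide_eq_true_eq]
  have := Box.coord_of_le v (j := l - 1)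
  grind

theorem cap_e_of_le {i j : ℕ} (τ : Shape) (h : i ≤ j) (hj : j ≤ N) (x : X.cubes N) :
    cap i (e τ j x) = e τ j (cap i x) := by
  refine act_congr fun v l => ?_
  simp (disch := omega) only [Box.coord_degN, Box.coord_raise, decide_eq_true_eq]
  have := Box.coord_of_le v (j := l + 1)
  grind [Shape.op_self]

/-- A cube that is constant in the coordinates from `i` on has only one degeneracy there, whatever
its shape and position. -/
theorem e_cap {i j k : ℕ} (τ τ' : Shape) (hij : i ≤ j) (hik : i ≤ k) (hj : j ≤ N) (hk : k ≤ N)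
    (x : X.cubes N) : e τ j (cap i x) = e τ' k (cap i x) := by
  refine act_congr fun v l => ?_
  simp (disch := omega) only [Box.coord_degN, Box.coord_raise, decide_eq_true_eq]
  have := Box.coord_of_le v (j := l + 1)
  grind

theorem cap_degen_of_le {i j : ℕ} (h : j ≤ i) (hj : j ≤ N) (x : X.cubes N) :
    cap (i + 1) (e .degen j x) = e .degen j (cap i x) := by
  refine act_congr fun v l => ?_
  simp (disch := omega) only [Box.coord_degN, Box.coord_raise, decide_eq_true_eq, Shape.op_degen]
  have := Box.coord_of_le v (j := l + 1)
  grind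

theorem cap_conn_of_le {i j : ℕ} (h : j ≤ i) (hj : j ≤ N) (x : X.cubes N) :
    cap (i + 1) (e (.conn false) j x) = e (.conn false) j (cap i x) := by
  refine act_congr fun v l => ?_
  simp (disch := omega) only [Box.coord_degN, Box.coord_raise, decide_eq_true_eq,
    Shape.op_conn_false]
  have := Box.coord_of_le v (j := l + 1)
  grind

theorem top_eq {i : ℕ} (hi : i ≤ N) (x : X.cubes (N + 1)) :
    top i x = e .degen i (d i true x) := by
  refine (act_congr_left fun v l => ?_).symm
  simp (disch := omega) only [Box.coord_faceN, Box.coord_degN, Box.coord_raise,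
    decide_eq_true_eq, Shape.op_degen]
  have := Box.coord_of_le v (j := l)
  grind

theorem top_of_le {i : ℕ} (h : N ≤ i) (x : X.cubes N) : top i x = x := by
  have : (Box.raise fun j => decide (j = i) : Box.mk N ⟶ Box.mk N) = 𝟙 _ := by
    refine Box.hom_ext_coord fun v l => ?_
    simp only [Box.coord_raise, decide_eq_true_eq]
    rw [if_neg (by omega)]
    rfl
  rw [top, this, act_id]

/-! ### Cones as cubes -/

/-- A cube is an `n`-cone if it does not depend on the coordinates following a coordinate `i < n`
that is equal to `1`. -/
def IsCone (n : ℕ) (x : X.cubes N) : Prop := ∀ i < n, top i x = cap i x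

theorem IsCone.mono {n n' : ℕ} {x : X.cubes N} (h : IsCone n x) (hn : n' ≤ n) : IsCone n' x :=
  fun i hi => h i (by omega)

theorem isCone_zero (x : X.cubes N) : IsCone 0 x := fun i hi => absurd hi (by omega)

theorem IsCone.of_cubes_zero (n : ℕ) (x : X.cubes 0) : IsCone n x := fun i _ => by
  rw [top_of_le (by omega), cap_of_le (by omega)]

/-- Since `top i x` is the degeneracy of the face of `x` at `i`, the cone condition only concerns
faces at 1. In this form the cubical identities apply to it. -/
theorem isCone_iff {n : ℕ} {x : X.cubes (N + 1)} :
    IsCone n x ↔ ∀ i < n, i ≤ N → cap i (d i true x) = d i true x := by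
  constructor
  · intro h i hi hiN
    have h1 := h i hi
    rw [top_eq hiN] at h1
    have h2 := congrArg (d i true) h1
    rw [d_degen_self hiN, d_cap_of_ge le_rfl le_rfl hiN hiN] at h2
    exact h2.symm
  · intro h i hi
    by_cases hiN : i ≤ N
    · have h1 : top i x = cap i (top i x) := by
        rw [top_eq hiN, cap_e_of_le _ le_rfl hiN, h i hi hiN]
      rw [h1]
      refine act_congr_left fun v l => ?_
      simp (disch := omega) only [Box.coord_raise, decide_eq_true_eq]
      grind
    · rw [top_of_le (by omega), cap_of_le (by omega)]

theorem IsCone.cap_d {n i : ℕ} {x : X.cubes (N + 1)} (h : IsCone n x) (hi : i < n) (hiN : i ≤ N) :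
    cap i (d i true x) = d i true x := isCone_iff.1 h i hi hiN

theorem IsCone.degen_d {n i : ℕ} {x : X.cubes (N + 1)} (h : IsCone n x) (hi : i < n)
    (hiN : i ≤ N) : e .degen i (d i true x) = cap i x := by
  rw [← top_eq hiN, h i hi]

/-- Faces of cones are cones. -/
theorem IsCone.d {n n' i : ℕ} {x : X.cubes (N + 1)} (h : IsCone n x) (hi : i ≤ N) (hn : n' ≤ n)
    (hin : i < n → n' < n) (ε : Bool) : IsCone n' (d i ε x) := by
  obtain _ | N := N
  · exact IsCone.of_cubes_zero _ _
  rw [isCone_iff] at h ⊢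
  intro k hk hkN
  -- Coordinate `k` of the face is coordinate `k` of `x` if `k < i` and coordinate `k + 1`
  -- otherwise. In the second case `hin` ensures `k + 1 < n`.
  by_cases hki : k < i
  · obtain ⟨i, rfl⟩ : ∃ l, i = l + 1 := ⟨i - 1, by omega⟩
    rw [d_d (by omega) (by omega), ← h k (by omega) (by omega),
      d_cap_of_ge (i := k) (j := i) (k := i) (by omega) (by omega) (by omega) (by omega), cap_cap,
      min_self]
  · rw [← d_d (by omega) (by omega), ← h (k + 1) (by omega) (by omega),
      d_cap_of_le (by omega) (by omega), cap_cap, min_self]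

/-- Degeneracies in the last coordinates of cones are cones. -/
theorem IsCone.e {n i : ℕ} {x : X.cubes N} (h : IsCone n x) (τ : Shape) (hi : n ≤ i)
    (hiN : i ≤ N) : IsCone n (e τ i x) := by
  rw [isCone_iff]
  intro k hk hkN
  obtain _ | N := N
  · rw [cap_of_le (by omega)]
  obtain ⟨i, rfl⟩ : ∃ l, i = l + 1 := ⟨i - 1, by omega⟩
  rw [d_e_of_lt (by omega) (by omega), cap_e_of_le _ (by omega) (by omega), h.cap_d hk (by omega)]

/-- The maximum is 1 as soon as one of its arguments is, so both coordinates read by the connection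
become cone coordinates. -/
theorem IsCone.conn_lo {n i : ℕ} {x : X.cubes N} (h : IsCone n x) (hi : i < n) (hiN : i < N) :
    IsCone (n + 1) (CSet.e (.conn false) i x) := by
  rw [isCone_iff]
  intro k hk hkN
  obtain _ | N := N
  · rw [cap_of_le (by omega)]
  rcases lt_trichotomy k i with hki | rfl | hki
  · obtain ⟨i, rfl⟩ : ∃ l, i = l + 1 := ⟨i - 1, by omega⟩
    rw [d_e_of_lt (by omega) (by omega), cap_e_of_le _ (by omega) (by omega),
      h.cap_d (by omega) (by omega)]
  · rw [d_true_conn (by omega), cap_e_of_le _ (by omega) (by omega),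
      h.cap_d (by omega) (by omega)]
  · obtain ⟨k, rfl⟩ : ∃ l, k = l + 1 := ⟨k - 1, by omega⟩
    by_cases hki' : k = i
    · subst hki'
      rw [d_true_conn_succ (by omega), cap_degen_of_le le_rfl (by omega),
        h.cap_d (by omega) (by omega)]
    · rw [d_e_of_gt _ (by simp; omega) (by omega), cap_conn_of_le (by omega) (by omega),
        h.cap_d (by omega) (by omega)]

theorem IsCone.of_e {n i : ℕ} {x : X.cubes N} {τ : Shape} (h : IsCone n (CSet.e τ i x))
    (hi : n ≤ i) (hiN : i ≤ N) : IsCone n x := by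
  obtain ⟨ε, hε⟩ := exists_d_e (X := X) τ hiN
  rw [← hε x]
  exact h.d hiN le_rfl (by omega) ε

/-- The first `i` coordinates are covered by the cone condition on `x`, and on the later ones the
cube is constant. -/
theorem isCone_cap {n i : ℕ} {x : X.cubes N} (h : IsCone i x) : IsCone n (cap i x) := by
  intro k hk
  by_cases hki : k < i
  · have h1 : top k (cap i x) = cap i (top k x) := by
      refine act_congr fun v l => ?_
      simp (disch := omega) only [Box.coord_raise, decide_eq_true_eq]
      grind
    rw [h1, h k hki, cap_cap, cap_cap, min_comm]
  · rw [cap_cap, min_eq_right (by omega)]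
    refine act_congr_left fun v l => ?_
    simp (disch := omega) only [Box.coord_raise, decide_eq_true_eq]
    grind

/-! ### The conditions on a value of θ -/

/-- The conditions on `z = θ(x)`, for an `n`-cone `x`, that only involve `x`. -/
structure BaseAt (n : ℕ) (x : X.cubes N) (z : X.cubes (N + 1)) : Prop where
  self : d n false z = x
  -- Auxiliary: it makes `z` an `(n+1)`-cone (`BaseAt.isCone`) and computes the relevant faces at 1
  -- from `x`.
  one : ∀ i ≤ n, d i true z = cap i x
  -- Auxiliary: once the coordinates after `n` are set to 1, `z` is degenerate in direction `n`. It
  -- is carried along for the case where `x` is itself a value of θ.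
  cap : cap (n + 1) z = e .degen n (cap n x)
  -- For `n = N` the hypothesis holds automatically, and by the convention in `degN` the connection
  -- is then the last degeneracy.
  cone : IsCone (n + 1) x → z = e (.conn false) n x

/-- The conditions on `z = θ(x)`, for an `n`-cone `x`, that involve the values `f` of `θ` in the
preceding dimension. -/
structure RelAt (f : ℕ → X.cubes N → X.cubes (N + 1)) (n : ℕ) (x : X.cubes (N + 1))
    (z : X.cubes (N + 2)) : Prop where
  -- The fields correspond in turn to `face_zero`, `face_one`, `degen` together with `conn_high`,
  -- `conn_low`, and `theta_theta`.
  zero : ∀ k, n = k + 1 → ∀ i ≤ k, d i false z = f k (d i false x)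
  one : ∀ i, n ≤ i → i ≤ N → d (i + 1) true z = f n (d i true x)
  -- The bound involving `width` excludes the out-of-range connections that `degN` turns into
  -- degeneracies.
  hi : ∀ (τ : Shape) (i : ℕ) (y : X.cubes N), n ≤ i → i + τ.width ≤ N + 1 → IsCone n y →
    x = e τ i y → z = e τ (i + 1) (f n y)
  lo : ∀ (k i : ℕ) (y : X.cubes N), n = k + 1 → i < k → IsCone k y →
    x = e (.conn false) i y → z = e (.conn false) i (f k y)
  self : ∀ (k : ℕ) (y : X.cubes N), n = k + 1 → IsCone k y → x = f k y →
    z = e (.conn false) k x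

/-- The conditions of `BaseAt` for all cones. -/
def Base (f : ℕ → X.cubes N → X.cubes (N + 1)) : Prop :=
  ∀ n ≤ N, ∀ x : X.cubes N, IsCone n x → BaseAt n x (f n x)

/-- The conditions of `RelAt` for all cones. -/
def Rel (f : ℕ → X.cubes N → X.cubes (N + 1)) (g : ℕ → X.cubes (N + 1) → X.cubes (N + 2)) : Prop :=
  ∀ n ≤ N + 1, ∀ x : X.cubes (N + 1), IsCone n x → RelAt f n x (g n x)

theorem BaseAt.isCone {n : ℕ} {x : X.cubes N} {z : X.cubes (N + 1)} (h : BaseAt n x z) :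
    IsCone (n + 1) z := by
  rw [isCone_iff]
  intro i hi _
  rw [h.one i (by omega), cap_cap, min_self]

theorem IsCone.cap_eq {n i : ℕ} {x : X.cubes (N + 1)} (h : IsCone n x) (hi : i < n) (hiN : i ≤ N)
    (τ : Shape) {j : ℕ} (hij : i ≤ j) (hj : j ≤ N) : CSet.e τ j (CSet.d i true x) = cap i x := by
  rw [← h.degen_d hi hiN, ← h.cap_d hi hiN]
  exact e_cap _ _ hij le_rfl hj hiN _

/-! ### The value on an `(n+1)`-cone -/

theorem baseAt_conn {n : ℕ} {x : X.cubes (N + 1)} (hn : n ≤ N + 1) (hx : IsCone n x)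
    (hx' : IsCone (n + 1) x) : BaseAt n x (e (.conn false) n x) where
  self := d_conn_self hn _ _
  one i hi := by
    rcases hi.lt_or_eq with hi | rfl
    · obtain ⟨n, rfl⟩ : ∃ l, n = l + 1 := ⟨n - 1, by omega⟩
      rw [d_e_of_lt (by omega) (by omega), hx.cap_eq (by omega) (by omega) _ (by omega) (by omega)]
    · rcases hn.lt_or_eq with hi | rfl
      · rw [d_true_conn (by omega), hx'.cap_eq (by omega) (by omega) _ (by omega) (by omega)]
      · have : ∀ y : X.cubes (N + 1), e (.conn false) (N + 1) y = e .degen (N + 1) y := fun y => by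
          rw [← cap_of_le le_rfl y]
          exact e_cap _ _ le_rfl le_rfl le_rfl le_rfl _
        rw [this, d_degen_self le_rfl, cap_of_le le_rfl]
  cap := by
    rw [cap_conn_of_le le_rfl hn]
    exact e_cap _ _ le_rfl le_rfl hn hn _
  cone _ := rfl

/-- Being constant from `n` on, `y` is an `(n+1)`-cone, so its value is a connection; and all
degeneracies of `y` beyond `n` agree. -/
theorem Base.apply_cap {f : ℕ → X.cubes N → X.cubes (N + 1)} (hf : Base f) {n : ℕ} (hn : n ≤ N)
    {y : X.cubes N} (hy : IsCone n y) (h : cap n y = y) (τ : Shape) {j : ℕ} (hj : n ≤ j)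
    (hjN : j ≤ N) : f n y = e τ j y := by
  have h1 : IsCone (n + 1) y := by
    rw [← h]
    exact isCone_cap hy
  rw [(hf n hn y hy).cone h1, ← h]
  exact e_cap _ _ le_rfl hj hn hjN _

/-- The cubes of lower dimension that occur in the identities are again `(n+1)`-cones or constant
from `n` on, so `Base` gives their values explicitly. -/
theorem relAt_conn {f : ℕ → X.cubes N → X.cubes (N + 1)} (hf : Base f) {n : ℕ}
    {x : X.cubes (N + 1)} (hn : n ≤ N + 1) (hx' : IsCone (n + 1) x) :
    RelAt f n x (e (.conn false) n x) where
  zero k hk i hi := by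
    subst hk
    have hc : IsCone (k + 1) (d i false x) := hx'.d (by omega) (by omega) (by omega) _
    rw [d_e_of_lt (by omega) (by omega), (hf k (by omega) _ (hc.mono (by omega))).cone hc]
  one i hi hiN := by
    rcases hi.lt_or_eq with hi | rfl
    · have hc : IsCone (n + 1) (d i true x) := hx'.d (by omega) (by omega) (by omega) _
      rw [d_e_of_gt _ (by simp; omega) (by omega),
        (hf n (by omega) _ (hc.mono (by omega))).cone hc]
    · have hc : IsCone n (d n true x) := hx'.d (by omega) (by omega) (by omega) _
      rw [d_true_conn_succ (by omega), hf.apply_cap (by omega) hc (hx'.cap_d (by omega) (by omega))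
        .degen le_rfl (by omega)]
  hi τ i y hi hiN hy hxy := by
    have hw : 1 ≤ τ.width := by rcases τ with _ | _ <;> simp
    rcases hi.lt_or_eq with hi | rfl
    · rw [hxy] at hx'
      rw [hxy, (hf n (by omega) _ hy).cone (hx'.of_e (by omega) (by omega)),
        e_e _ _ (by simp; omega) (by omega)]
    -- Here the operator acts at `n` itself. The cone condition on `x` at `n` makes `y` constant
    -- from `n` on for a degeneracy or a minimum, while for a maximum `y` is only an `(n+1)`-cone.
    · rcases τ with _ | _ | _
      · have h1 : d n true x = y := by rw [hxy, d_degen_self (by omega)]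
        have h2 := hx'.cap_d (i := n) (by omega) (by omega)
        rw [h1] at h2
        rw [hf.apply_cap (by omega) hy h2 .degen le_rfl (by omega), hxy,
          conn_degen _ (by omega), e_e _ _ (by simp) (by omega)]
      · have h1 : d (n + 1) false x = y := by rw [hxy, d_conn_succ (by simp at hiN; omega)]
        have hc : IsCone (n + 1) (d (n + 1) false x) :=
          hx'.d (by simp at hiN; omega) (by omega) (by omega) _
        rw [h1] at hc
        rw [(hf n (by omega) _ hy).cone hc, hxy, conn_conn _ (by omega)]
      · have h1 : d n true x = y := by rw [hxy, d_conn_self (by omega)]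
        have h2 := hx'.cap_d (i := n) (by omega) (by omega)
        rw [h1] at h2
        have h3 : e (.conn true) n y = e .degen n y := by
          rw [← h2]
          exact e_cap _ _ le_rfl le_rfl (by omega) (by omega) _
        rw [hf.apply_cap (by omega) hy h2 .degen le_rfl (by omega), hxy, h3,
          conn_degen _ (by omega), ← e_e _ _ (by simp) (by omega), h3]
  lo k i y hk hi hy hxy := by
    subst hk
    have h1 : d i false x = y := by rw [hxy, d_conn_self (by omega)]
    have hc : IsCone (k + 1) (d i false x) := hx'.d (by omega) (by omega) (by omega) _
    rw [h1] at hc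
    rw [(hf k (by omega) _ hy).cone hc, hxy, e_e (i := i) (k := k) _ _ (by simp; omega) (by omega)]
  self k y hk hy hxy := by
    subst hk
    have hy' : BaseAt k y (f k y) := hf k (by omega) _ hy
    have h1 : d k false x = y := by rw [hxy, hy'.self]
    have hc : IsCone (k + 1) (d k false x) := hx'.d (by omega) (by omega) (by omega) _
    rw [h1] at hc
    rw [hxy, hy'.cone hc, conn_conn _ (by omega)]

/-! ### Comparing two presentations of a degenerate cube -/

/-- If the operators read disjoint coordinates, or are equal connections at adjacent positions, a
face cancelling the first one commutes with the second and yields the common base `w`. If distinct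
operators overlap, comparing faces in a shared direction forces `y = y'` and makes this cube
degenerate. The third alternative records as much of that degeneracy as `e_eq_e_of_degenerate`
requires. -/
theorem exists_common_degeneracy {τ τ' : Shape} {i j : ℕ} {y y' : X.cubes (N + 1)} (hij : i ≤ j)
    (hi : i + τ.width ≤ N + 2) (hj : j + τ'.width ≤ N + 2) (h : e τ i y = e τ' j y') :
    (τ = τ' ∧ i = j ∧ y = y') ∨
    (∃ w : X.cubes N, ∃ k, j = k + 1 ∧ i ≤ k ∧ y = e τ' k w ∧ y' = e τ i w ∧
      (i + τ.width ≤ j ∨ ∃ ε, k = i ∧ τ = .conn ε ∧ τ' = .conn ε)) ∨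
    (τ ≠ τ' ∧ y = y' ∧ j ≤ i + 1 ∧ (∃ w : X.cubes N, y = e .degen i w) ∧
      (τ' = .degen ∨ ∃ w : X.cubes N, y = e .degen j w)) := by
  have hw : 1 ≤ τ.width := by rcases τ with _ | _ <;> simp
  have hw' : 1 ≤ τ'.width := by rcases τ' with _ | _ <;> simp
  have commuting : ∀ k, j = k + 1 → i ≤ k →
      (i + τ.width ≤ j ∨ ∃ ε, k = i ∧ τ = .conn ε ∧ τ' = .conn ε) →
      ∃ w : X.cubes N, y = e τ' k w ∧ y' = e τ i w := by
    rintro k rfl hik hk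
    obtain ⟨ε, hε⟩ := exists_d_e (X := X) (N := N + 1) τ (i := i) (by omega)
    have h1 : y = e τ' k (d i ε y') := by
      rw [← hε y, h, d_e_of_lt hik (by omega)]
    refine ⟨d i ε y', h1, e_injective τ' (i := k + 1) (by omega) ?_⟩
    rw [← h]
    conv_lhs => rw [h1]
    rcases hk with hk | ⟨ε, rfl, rfl, rfl⟩
    · exact e_e _ _ hk (by omega) _
    · exact conn_conn _ (by omega) _
  rcases hij.lt_or_eq with hij | rfl
  · obtain ⟨k, rfl⟩ : ∃ k, j = k + 1 := ⟨j - 1, by omega⟩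
    by_cases hk : i + τ.width ≤ k + 1
    · obtain ⟨w, h1, h2⟩ := commuting k rfl (by omega) (Or.inl hk)
      exact Or.inr (Or.inl ⟨w, k, rfl, by omega, h1, h2, Or.inl hk⟩)
    · obtain _ | ε := τ
      · simp at hk; omega
      · obtain rfl : k = i := by simp at hk; omega
        obtain _ | ε' := τ'
        · refine Or.inr (Or.inr ⟨by simp, ?_, le_rfl, ?_, Or.inl rfl⟩)
          · rw [← d_conn_succ (i := k) (by simp at hi; omega) ε y, h, d_degen_self (by omega)]
          · have h1 := congrArg (d (k + 1) ε) h
            have h2 := congrArg (d (k + 1) (!ε)) h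
            rw [d_degen_self (by omega), d_conn_succ (by simp at hi; omega)] at h1
            rw [d_degen_self (by omega), d_conn_not_succ (by simp at hi; omega)] at h2
            exact ⟨_, h1.trans h2.symm⟩
        · by_cases hε : ε = ε'
          · subst hε
            obtain ⟨w, h1, h2⟩ := commuting k rfl le_rfl (Or.inr ⟨ε, rfl, rfl, rfl⟩)
            exact Or.inr (Or.inl ⟨w, k, rfl, le_rfl, h1, h2, Or.inr ⟨ε, rfl, rfl, rfl⟩⟩)
          · obtain rfl : ε' = !ε := by cases ε <;> cases ε' <;> simp_all
            simp at hi hj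
            obtain ⟨N, rfl⟩ : ∃ l, N = l + 1 := ⟨N - 1, by omega⟩
            -- For opposite connections at adjacent positions, each of `y` and `y'` is a degeneracy
            -- of a face of the other. Substituting one expression into the other shows that the
            -- remaining face is degenerate in direction `k`, whence `y = y'`.
            have h1 : y = e .degen (k + 1) (d (k + 1) ε y') := by
              rw [← d_conn_succ (i := k) (by omega) ε y, h]
              simpa using d_conn_not (i := k + 1) (by omega) (!ε) y'
            have h2 : y' = e .degen k (d k (!ε) y) := by
              rw [← d_conn_self (i := k + 1) (by omega) (!ε) y', ← h]
              exact d_conn_not_succ (by omega) ε y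
            have h3 : d k (!ε) y = e .degen k (d k (!ε) (d (k + 1) ε y')) := by
              conv_lhs => rw [h1]
              exact d_e_of_lt le_rfl (by omega) _ _ _
            rw [h3, e_e _ _ (by simp) (by omega)] at h2
            have h4 : d (k + 1) ε y' = e .degen k (d k (!ε) (d (k + 1) ε y')) := by
              conv_lhs => rw [h2]
              exact d_degen_self (by omega) _ _
            have h5 : y = y' := by
              rw [h2, ← h4, ← h1]
            have h6 : e .degen k (d (k + 1) ε y') = y' := by
              conv_lhs => rw [h4]
              rw [e_e _ _ (by simp) (by omega), ← h2]
            exact Or.inr (Or.inr ⟨by simp, h5, le_rfl, ⟨_, h5.trans h6.symm⟩, Or.inr ⟨_, h1⟩⟩)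
  · obtain _ | ε := τ <;> obtain _ | ε' := τ'
    · exact Or.inl ⟨rfl, rfl, e_injective _ (by omega) h⟩
    · have h1 := congrArg (d i ε') h
      have h2 := congrArg (d i (!ε')) h
      rw [d_degen_self (by omega), d_conn_self (by omega)] at h1
      rw [d_degen_self (by omega), d_conn_not (by simp at hj; omega)] at h2
      exact Or.inr (Or.inr ⟨by simp, h1, by omega, ⟨_, h2⟩, Or.inr ⟨_, h2⟩⟩)
    · have h1 := congrArg (d i ε) h
      have h2 := congrArg (d i (!ε)) h
      rw [d_degen_self (by omega), d_conn_self (by omega)] at h1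
      rw [d_degen_self (by omega), d_conn_not (by simp at hi; omega)] at h2
      exact Or.inr (Or.inr ⟨by simp, h1, by omega, ⟨_, h1.trans h2.symm⟩, Or.inl rfl⟩)
    · by_cases hε : ε = ε'
      · subst hε
        exact Or.inl ⟨rfl, rfl, e_injective _ (by omega) h⟩
      · obtain rfl : ε' = !ε := by cases ε <;> cases ε' <;> simp_all
        simp at hi
        have h1 : y = e .degen i (d i ε y') := by
          rw [← d_conn_self (i := i) (by omega) ε y, h]
          simpa using d_conn_not (i := i) (by omega) (!ε) y'
        have h2 : y' = e .degen i (d i (!ε) y) := by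
          rw [← d_conn_self (i := i) (by omega) (!ε) y', ← h, d_conn_not (by omega)]
        have h3 : d i ε y' = d i (!ε) y := by
          conv_lhs => rw [h2]
          exact d_degen_self (by omega) _ _
        have h4 : y = y' := by rw [h1, h3, ← h2]
        exact Or.inr (Or.inr ⟨by simp, h4, by omega, ⟨_, h1⟩, Or.inr ⟨_, h1⟩⟩)

theorem e_degen (τ : Shape) {i : ℕ} (hi : i ≤ N) (x : X.cubes N) :
    e τ i (e .degen i x) = e .degen i (e .degen i x) := by
  rcases τ with _ | ε
  · rfl
  · exact conn_degen ε hi x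

/-- A connection and the degeneracy with the same index agree on a cube degenerate in that
direction. This settles the exceptional alternative above. -/
theorem e_eq_e_of_degenerate {τ τ' : Shape} {i j : ℕ} {y : X.cubes (N + 1)} (hij : i ≤ j)
    (hji : j ≤ i + 1) (hi : i ≤ N) (hj : j ≤ N + 1) (h : ∃ w : X.cubes N, y = e .degen i w)
    (h' : τ' = .degen ∨ j ≤ N ∧ ∃ w : X.cubes N, y = e .degen j w) : e τ i y = e τ' j y := by
  have h1 : e τ' j y = e .degen j y := by
    rcases h' with rfl | ⟨hj, w, rfl⟩
    · rfl
    · exact e_degen _ hj _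
  rw [h1]
  obtain ⟨w, rfl⟩ := h
  rw [e_degen _ hi]
  obtain rfl | rfl : j = i ∨ j = i + 1 := by omega
  · rfl
  · exact e_e _ _ (by simp) hi _

/-! ### Inductive step: the dictated values -/

section Step

variable {f : ℕ → X.cubes N → X.cubes (N + 1)} {g : ℕ → X.cubes (N + 1) → X.cubes (N + 2)}
  {n : ℕ} {x : X.cubes (N + 2)}

/-- `Rel` carries both sides to the value at the common base `w`. In the exceptional alternative `y
= y'`, and its value inherits the degeneracy one index higher, so the two operators agree on it. -/
theorem hi_unique (hg : Rel f g) {τ τ' : Shape} {i j : ℕ} {y y' : X.cubes (N + 1)} (hij : i ≤ j)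
    (hi : i + τ.width ≤ N + 2) (hj : j + τ'.width ≤ N + 2) (hn : n ≤ i) (hy : IsCone n y)
    (hy' : IsCone n y') (h : e τ i y = e τ' j y') :
    e τ (i + 1) (g n y) = e τ' (j + 1) (g n y') := by
  have hw : 1 ≤ τ.width := by rcases τ with _ | _ <;> simp
  have hw' : 1 ≤ τ'.width := by rcases τ' with _ | _ <;> simp
  rcases exists_common_degeneracy hij hi hj h with ⟨rfl, rfl, rfl⟩ |
    ⟨w, k, rfl, hik, h1, h2, h3⟩ | ⟨h0, h1, h2, ⟨w, h3⟩, h4⟩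
  · rfl
  · have hk : i ≤ N := by
      rcases h3 with h3 | ⟨ε, rfl, rfl, rfl⟩
      · omega
      · simp at hj; omega
    have hwc : IsCone n w := by
      rw [h1] at hy
      exact hy.of_e (by omega) (by omega)
    have hiN : i + τ.width ≤ N + 1 := by
      rcases h3 with h3 | ⟨ε, rfl, rfl, rfl⟩
      · omega
      · simpa using hj
    rw [(hg n (by omega) y hy).hi τ' k w (by omega) (by omega) hwc h1,
      (hg n (by omega) y' hy').hi τ i w (by omega) hiN hwc h2]
    rcases h3 with h3 | ⟨ε, rfl, rfl, rfl⟩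
    · exact e_e _ _ (by omega) (by omega) _
    · exact conn_conn _ (by omega) _
  · subst h1
    have hi' : i ≤ N := by
      by_contra hi'
      obtain rfl : i = N + 1 := by omega
      obtain rfl : j = N + 1 := by omega
      rcases τ with _ | _ <;> rcases τ' with _ | _ <;> simp at hi hj h0
    have hwc : IsCone n w := by
      rw [h3] at hy
      exact hy.of_e hn hi'
    refine e_eq_e_of_degenerate (by omega) (by omega) (by omega) (by omega)
      ⟨_, (hg n (by omega) y hy).hi .degen i w hn (by simpa using hi') hwc h3⟩ ?_
    rcases h4 with rfl | ⟨w', h4⟩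
    · exact Or.inl rfl
    · rcases τ' with _ | ε
      · exact Or.inl rfl
      · simp at hj
        have hwc' : IsCone n w' := by
          rw [h4] at hy
          exact hy.of_e (by omega) (by omega)
        exact Or.inr ⟨by omega, _, (hg n (by omega) y hy).hi .degen j w' (by omega)
          (by simp; omega) hwc' h4⟩

/-- The low connection reads coordinates up to `k` and the other operator reads coordinates from `k
+ 1` on, so only the commuting alternative is possible. -/
theorem lo_hi_unique (hg : Rel f g) {τ : Shape} {i j k : ℕ} {y y' : X.cubes (N + 1)} (hik : i < k)
    (hj : j + τ.width ≤ N + 2) (hkj : k + 1 ≤ j) (hy : IsCone k y) (hy' : IsCone (k + 1) y')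
    (h : e (.conn false) i y = e τ j y') :
    e (.conn false) i (g k y) = e τ (j + 1) (g (k + 1) y') := by
  have hw : 1 ≤ τ.width := by rcases τ with _ | _ <;> simp
  rcases exists_common_degeneracy (by omega) (by simp; omega) hj h with ⟨h1, h2, h3⟩ |
    ⟨w, l, rfl, hil, h1, h2, h3⟩ | ⟨h0, h1, h2, _⟩
  · omega
  · have hwc : IsCone k w := by
      rw [h1] at hy
      exact hy.of_e (by omega) (by omega)
    rw [(hg k (by omega) y hy).hi τ l w (by omega) (by omega) hwc h1,
      (hg (k + 1) (by omega) y' hy').lo k i w rfl hik hwc h2]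
    exact e_e _ _ (by simp; omega) (by omega) _
  · omega

/-- Both operators have the same shape, which excludes the exceptional alternative. -/
theorem lo_unique (hg : Rel f g) {i j k : ℕ} {y y' : X.cubes (N + 1)} (hij : i ≤ j) (hjk : j < k)
    (hk : k ≤ N + 1) (hy : IsCone k y) (hy' : IsCone k y')
    (h : e (.conn false) i y = e (.conn false) j y') :
    e (.conn false) i (g k y) = e (.conn false) j (g k y') := by
  rcases exists_common_degeneracy hij (by simp; omega) (by simp; omega) h with ⟨h1, rfl, rfl⟩ |
    ⟨w, l, rfl, hil, h1, h2, h3⟩ | ⟨h0, _⟩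
  · rfl
  · obtain ⟨k, rfl⟩ : ∃ l, k = l + 1 := ⟨k - 1, by omega⟩
    have hwc : IsCone k w := by
      rw [← d_conn_self (i := l) (by omega) false w, ← h1]
      exact hy.d (by omega) (by omega) (by omega) _
    rw [(hg (k + 1) (by omega) y hy).lo k l w rfl (by omega) hwc h1,
      (hg (k + 1) (by omega) y' hy').lo k i w rfl (by omega) hwc h2]
    rcases h3 with h3 | ⟨ε, rfl, h3⟩
    · exact e_e _ _ (by simp; simp at h3; omega) (by omega) _
    · exact conn_conn _ (by omega) _
  · exact absurd rfl h0

theorem baseAt_self (hg : Base g) {k : ℕ} (hk : k ≤ N + 1) {y : X.cubes (N + 1)} (hy : IsCone k y)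
    (hx : IsCone (k + 1) x) (hx' : ¬ IsCone (k + 2) x) (hxy : x = g k y) :
    BaseAt (k + 1) x (e (.conn false) k x) where
  self := d_conn_succ (by omega) _ _
  one i hi := by
    rcases hi.lt_or_eq with hi | rfl
    · rcases (Nat.lt_succ_iff.1 hi).lt_or_eq with hi | rfl
      · obtain ⟨k, rfl⟩ : ∃ l, k = l + 1 := ⟨k - 1, by omega⟩
        rw [d_e_of_lt (by omega) (by omega),
          hx.cap_eq (by omega) (by omega) _ (by omega) (by omega)]
      · rw [d_true_conn (by omega), hx.cap_eq (by omega) (by omega) _ (by omega) (by omega)]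
    · rw [d_true_conn_succ (by omega), hx.cap_eq (by omega) (by omega) _ le_rfl (by omega)]
      -- The clause `cap` is needed here: with the coordinates after `k` set to 1, a value of θ does
      -- not depend on coordinate `k`, so `cap k x = cap (k + 1) x`.
      have h1 : cap (k + 1) x = e .degen k (cap k y) := by rw [hxy, (hg k hk y hy).cap]
      have h2 : cap k (cap (k + 1) x) = cap k x := by rw [cap_cap, min_eq_left (by omega)]
      rw [← h2, h1, cap_e_of_le _ le_rfl hk, cap_cap, min_self]
  cap := by
    have h1 : cap (k + 1) x = e .degen k (cap k y) := by rw [hxy, (hg k hk y hy).cap]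
    rw [cap_conn_of_le (by omega) (by omega), h1, conn_degen _ hk, e_e _ _ (by simp) hk]
  cone h := absurd h hx'

/-- The face of `x` at `k` and 0 is `y`, so a degenerate presentation of `x` descends to `y`.
Applying `Rel` to `y` and cancelling the injective operator shows that the base of the presentation
is, in the nontrivial cases, itself a value of θ. The clause `self` one dimension lower then
applies. -/
theorem relAt_self (hg : Base g) (hfg : Rel f g) {k : ℕ} (hk : k ≤ N + 1) {y : X.cubes (N + 1)}
    (hy : IsCone k y) (hxy : x = g k y) : RelAt g (k + 1) x (e (.conn false) k x) where
  zero k' hk' i hi := by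
    obtain rfl : k = k' := by omega
    rcases hi.lt_or_eq with hi | rfl
    · obtain ⟨k, rfl⟩ : ∃ l, k = l + 1 := ⟨k - 1, by omega⟩
      have hc : IsCone (k + 1) (d i false x) := by
        rw [hxy]
        exact (hg _ hk y hy).isCone.d (by omega) (by omega) (by omega) _
      rw [d_e_of_lt (by omega) (by omega)]
      refine ((hfg (k + 1) (by omega) _ hc).self k (d i false y) rfl
        (hy.d (by omega) (by omega) (by omega) _) ?_).symm
      rw [hxy, (hfg _ hk y hy).zero k rfl i (by omega)]
    · rw [d_conn_self (by omega), hxy, (hg _ hk y hy).self]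
  one i hi hiN := by
    have hc : IsCone (k + 1) (d i true x) := by
      rw [hxy]
      exact (hg _ hk y hy).isCone.d (by omega) (by omega) (by omega) _
    obtain ⟨i, rfl⟩ : ∃ l, i = l + 1 := ⟨i - 1, by omega⟩
    rw [d_e_of_gt _ (by simp; omega) (by omega)]
    refine ((hfg (k + 1) (by omega) _ hc).self k (d i true y) rfl
        (hy.d (by omega) (by omega) (by omega) _) ?_).symm
    rw [hxy, (hfg _ hk y hy).one i (by omega) (by omega)]
  hi τ i w hi hiN hw hxw := by
    have hτ : 1 ≤ τ.width := by rcases τ with _ | _ <;> simp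
    obtain ⟨i, rfl⟩ : ∃ l, i = l + 1 := ⟨i - 1, by omega⟩
    have h1 : y = e τ i (d k false w) := by
      rw [← (hg _ hk y hy).self, ← hxy, hxw, d_e_of_lt (by omega) (by omega)]
    have hc : IsCone k (d k false w) := hw.d (by omega) (by omega) (by omega) _
    have h2 := (hfg k hk y hy).hi τ i _ (by omega) (by omega) hc h1
    rw [← hxy, hxw] at h2
    have h3 := e_injective _ (by omega) h2
    rw [(hfg (k + 1) (by omega) w hw).self k _ rfl hc h3, hxw,
      e_e _ _ (by simp; omega) (by omega)]
  lo k' i w hk' hi hw hxw := by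
    obtain rfl : k = k' := by omega
    obtain ⟨k, rfl⟩ : ∃ l, k = l + 1 := ⟨k - 1, by omega⟩
    rcases (Nat.lt_succ_iff.1 hi).lt_or_eq with hi | rfl
    · have h1 : y = e (.conn false) i (d k false w) := by
        rw [← (hg _ hk y hy).self, ← hxy, hxw, d_e_of_gt _ (by simp; omega) (by omega)]
      have hc : IsCone k (d k false w) := hw.d (by omega) (by omega) (by omega) _
      have h2 := (hfg _ hk y hy).lo k i _ rfl hi hc h1
      rw [← hxy, hxw] at h2
      have h3 := e_injective _ (by omega) h2
      rw [(hfg (k + 1) (by omega) w hw).self k _ rfl hc h3, hxw,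
        e_e (i := i) (k := k) _ _ (by simp; omega) (by omega)]
    · have h1 : y = w := by
        rw [← (hg _ hk y hy).self, ← hxy, hxw, d_conn_succ (by omega)]
      rw [← h1, ← hxy, hxw, conn_conn _ (by omega)]
  self k' _ hk' _ _ := by
    obtain rfl : k = k' := by omega
    rfl

theorem baseAt_hi (hg : Base g) {τ : Shape} {i : ℕ} (hi : n ≤ i) (hiN : i + τ.width ≤ N + 2)
    {y : X.cubes (N + 1)} (hy : IsCone n y) (hxy : x = e τ i y) (hx : ¬ IsCone (n + 1) x) :
    BaseAt n x (e τ (i + 1) (g n y)) := by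
  have hτ : 1 ≤ τ.width := by rcases τ with _ | _ <;> simp
  have hgy := hg n (by omega) y hy
  refine ⟨?_, fun j hj => ?_, ?_, fun h => absurd h hx⟩
  · rw [d_e_of_lt (by omega) (by omega), hgy.self, hxy]
  · rw [d_e_of_lt (by omega) (by omega), hgy.one j hj, hxy, cap_e_of_le _ (by omega) (by omega)]
  · rw [cap_e_of_le _ (by omega) (by omega), hgy.cap, hxy, cap_e_of_le _ (by omega) (by omega),
      ← e_e _ _ (by simp; omega) (by omega)]

/-- A face either commutes with the operator, cancels it, or turns a maximum into a degeneracy; in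
each case `Rel` gives the required value. Other degenerate presentations of `x` are covered by the
uniqueness lemmas. -/
theorem relAt_hi (hfg : Rel f g) {τ : Shape} {i : ℕ} (hi : n ≤ i)
    (hiN : i + τ.width ≤ N + 2) {y : X.cubes (N + 1)} (hy : IsCone n y) (hxy : x = e τ i y)
    (hx : ∀ k y, n = k + 1 → IsCone k y → x ≠ g k y) :
    RelAt g n x (e τ (i + 1) (g n y)) := by
  have hτ : 1 ≤ τ.width := by rcases τ with _ | _ <;> simp
  have hgy := hfg n (by omega) y hy
  refine ⟨?_, fun j hj hjN => ?_, ?_, ?_, fun k w hk hw h => absurd h (hx k w hk hw)⟩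
  · rintro k rfl j hj
    obtain ⟨i, rfl⟩ : ∃ l, i = l + 1 := ⟨i - 1, by omega⟩
    have hc : IsCone k (d j false y) := hy.d (by omega) (by omega) (by omega) _
    rw [d_e_of_lt (by omega) (by omega), hgy.zero k rfl j hj, hxy, d_e_of_lt (by omega) (by omega)]
    exact ((hfg k (by omega) _ (hc.e τ (i := i) (by omega) (by omega))).hi τ i _ (by omega)
      (by omega) hc rfl).symm
  · by_cases hji : j < i
    · obtain ⟨i, rfl⟩ : ∃ l, i = l + 1 := ⟨i - 1, by omega⟩
      have hc : IsCone n (d j true y) := hy.d (by omega) (by omega) (by omega) _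
      rw [d_e_of_lt (by omega) (by omega), hgy.one j hj (by omega), hxy,
        d_e_of_lt (by omega) (by omega)]
      exact ((hfg n (by omega) _ (hc.e τ (i := i) (by omega) (by omega))).hi τ i _ (by omega)
        (by omega) hc rfl).symm
    · by_cases hij : i + τ.width ≤ j
      · obtain ⟨j, rfl⟩ : ∃ l, j = l + 1 := ⟨j - 1, by omega⟩
        have hc : IsCone n (d j true y) := hy.d (by omega) (by omega) (by omega) _
        rw [d_e_of_gt _ (by omega) (by omega), hgy.one j (by omega) (by omega), hxy,
          d_e_of_gt _ (by omega) (by omega)]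
        exact ((hfg n (by omega) _ (hc.e τ (i := i) (by omega) (by omega))).hi τ i _ (by omega)
          (by omega) hc rfl).symm
      · rcases τ with _ | _ | _
        · obtain rfl : j = i := by simp at hij; omega
          rw [d_degen_self (by omega), hxy, d_degen_self (by omega)]
        · have hc : IsCone n (d i true y) := hy.d (by simp at hiN; omega) (by omega) (by omega) _
          have h := ((hfg n (by omega) _ (hc.e .degen (i := i) (by omega)
            (by simp at hiN; omega))).hi .degen i _ (by omega) (by simpa using hiN) hc rfl).symm
          simp at hij hiN
          obtain rfl | rfl : j = i ∨ j = i + 1 := by omega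
          · rw [d_true_conn (by omega), hgy.one j (by omega) (by omega), hxy,
              d_true_conn (by omega), h]
          · rw [d_true_conn_succ (by omega), hgy.one i (by omega) (by omega), hxy,
              d_true_conn_succ (by omega), h]
        · simp at hij hiN
          obtain rfl | rfl : j = i ∨ j = i + 1 := by omega
          · rw [d_conn_self (by omega), hxy, d_conn_self (by omega)]
          · rw [d_conn_succ (by omega), hxy, d_conn_succ (by omega)]
  · intro τ' j w hj hjN hw hxw
    rcases le_total i j with hij | hij
    · exact hi_unique hfg hij hiN (by omega) hi hy hw (hxy ▸ hxw)
    · exact (hi_unique hfg hij (by omega) hiN hj hw hy (hxw ▸ hxy)).symm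
  · rintro k j w rfl hj hw hxw
    exact (lo_hi_unique hfg hj hiN hi hw hy (hxw ▸ hxy)).symm

theorem baseAt_lo (hg : Base g) {k i : ℕ} (hi : i < k) (hk : k ≤ N + 1)
    {y : X.cubes (N + 1)} (hy : IsCone k y) (hxy : x = e (.conn false) i y)
    (hx : ¬ IsCone (k + 2) x) : BaseAt (k + 1) x (e (.conn false) i (g k y)) := by
  have hgy := hg k hk y hy
  refine ⟨?_, fun j hj => ?_, ?_, fun h => absurd h hx⟩
  · rw [d_e_of_gt _ (by simp; omega) (by omega), hgy.self, hxy]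
  · rw [hxy]
    rcases lt_or_ge j i with hji | hji
    · obtain ⟨i, rfl⟩ : ∃ l, i = l + 1 := ⟨i - 1, by omega⟩
      rw [d_e_of_lt (by omega) (by omega), hgy.one j (by omega),
        cap_e_of_le _ (by omega) (by omega)]
      exact e_cap _ _ (by omega) (by omega) (by omega) (by omega) _
    · rcases hji.lt_or_eq with hji | rfl
      · obtain ⟨j, rfl⟩ : ∃ l, j = l + 1 := ⟨j - 1, by omega⟩
        rw [cap_conn_of_le (by omega) (by omega)]
        rcases (Nat.lt_succ_iff.1 hji).lt_or_eq with hji | rfl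
        · rw [d_e_of_gt _ (by simp; omega) (by omega), hgy.one j (by omega)]
        · rw [d_true_conn_succ (by omega), hgy.one i (by omega)]
          exact e_cap _ _ (by omega) (by omega) (by omega) (by omega) _
      · rw [d_true_conn (by omega), hgy.one i (by omega), cap_e_of_le _ le_rfl (by omega)]
        exact e_cap _ _ (by omega) (by omega) (by omega) (by omega) _
  · rw [cap_conn_of_le (by omega) (by omega), hgy.cap, hxy, cap_conn_of_le (by omega) (by omega),
      e_e _ _ (by simp; omega) (by omega)]

theorem relAt_lo (hfg : Rel f g) {k i : ℕ} (hi : i < k) (hk : k ≤ N + 1)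
    {y : X.cubes (N + 1)} (hy : IsCone k y) (hxy : x = e (.conn false) i y)
    (hx : ∀ l y, k + 1 = l + 1 → IsCone l y → x ≠ g l y) :
    RelAt g (k + 1) x (e (.conn false) i (g k y)) := by
  have hgy := hfg k hk y hy
  refine ⟨?_, fun j hj hjN => ?_, ?_, ?_, fun k w hk hw h => absurd h (hx k w hk hw)⟩
  · intro k' hk' j hj
    obtain rfl : k = k' := by omega
    rw [hxy]
    obtain ⟨k, rfl⟩ : ∃ l, k = l + 1 := ⟨k - 1, by omega⟩
    rcases lt_or_ge j i with hji | hji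
    · obtain ⟨i, rfl⟩ : ∃ l, i = l + 1 := ⟨i - 1, by omega⟩
      have hc : IsCone k (d j false y) := hy.d (by omega) (by omega) (by omega) _
      rw [d_e_of_lt (by omega) (by omega), d_e_of_lt (by omega) (by omega),
        hgy.zero k rfl j (by omega)]
      exact ((hfg (k + 1) (by omega) _ (hc.conn_lo (i := i) (by omega) (by omega))).lo k i _ rfl
        (by omega) hc rfl).symm
    · rcases hji.lt_or_eq with hji | rfl
      · obtain ⟨j, rfl⟩ : ∃ l, j = l + 1 := ⟨j - 1, by omega⟩
        rcases (Nat.lt_succ_iff.1 hji).lt_or_eq with hji | rfl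
        · have hc : IsCone k (d j false y) := hy.d (by omega) (by omega) (by omega) _
          rw [d_e_of_gt _ (by simp; omega) (by omega), d_e_of_gt _ (by simp; omega) (by omega),
            hgy.zero k rfl j (by omega)]
          exact ((hfg (k + 1) (by omega) _ (hc.conn_lo (i := i) (by omega) (by omega))).lo k i _
            rfl (by omega) hc rfl).symm
        · rw [d_conn_succ (by omega), d_conn_succ (by omega)]
      · rw [d_conn_self (by omega), d_conn_self (by omega)]
  · rw [hxy]
    obtain ⟨j, rfl⟩ : ∃ l, j = l + 1 := ⟨j - 1, by omega⟩
    have hc : IsCone k (d j true y) := hy.d (by omega) (by omega) (by omega) _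
    rw [d_e_of_gt _ (by simp; omega) (by omega), d_e_of_gt _ (by simp; omega) (by omega),
      hgy.one j (by omega) (by omega)]
    exact ((hfg (k + 1) (by omega) _ (hc.conn_lo (i := i) (by omega) (by omega))).lo k i _ rfl
      (by omega) hc rfl).symm
  · intro τ j w hj hjN hw hxw
    exact lo_hi_unique hfg hi (by omega) hj hy hw (hxy ▸ hxw)
  · intro k' j w hk' hj hw hxw
    obtain rfl : k = k' := by omega
    rcases le_total i j with hij | hij
    · exact lo_unique hfg hij hj hk hy hw (hxy ▸ hxw)
    · exact (lo_unique hfg hij hi hk hw hy (hxw ▸ hxy)).symm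

end Step

end CSet

/-! ### Maps out of open boxes -/

namespace Box
theorem faceN_comp_degN {N : ℕ} {a b : ℕ} (hab : a ≤ b) (hb : b ≤ N) (δ : Bool) :
    faceN (n := N + 1) (b + 1) δ ≫ degN .degen a = degN .degen a ≫ faceN b δ := by
  refine hom_ext_coord fun v l => ?_
  rw [coord_comp, coord_comp]
  simp (disch := omega) only [coord_faceN, coord_degN, Shape.op_degen]
  grind

theorem faceN_comp_degN_succ {N : ℕ} {a b : ℕ} (hab : a ≤ b) (hb : b ≤ N) (δ : Bool) :
    faceN (n := N + 1) a δ ≫ degN .degen (b + 1) = degN .degen b ≫ faceN a δ := by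
  refine hom_ext_coord fun v l => ?_
  rw [coord_comp, coord_comp]
  simp (disch := omega) only [coord_faceN, coord_degN, Shape.op_degen]
  grind

theorem faceN_comp_degN_self {N : ℕ} {a : ℕ} (ha : a ≤ N) (δ : Bool) :
    faceN (n := N) a δ ≫ degN .degen a = 𝟙 _ := by
  refine hom_ext_coord fun v l => ?_
  rw [coord_comp]
  change _ = coord v l
  simp (disch := omega) only [coord_faceN, coord_degN, Shape.op_degen]
  grind

end Box

namespace CSet

variable {X : CSet.{u}} {N : ℕ}

/-- The cube `y` is the value at `p` of the map on the open box in `□ᴺ⁺²` with missing face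
`∂_{i,ε}` that is given by the cubes `B a δ` on the other faces. -/
def IsBoxValue (i : ℕ) (ε : Bool) (B : ℕ → Bool → X.cubes (N + 1)) {k : ℕ}
    (p : Box.mk k ⟶ Box.mk (N + 2)) (y : X.cubes k) : Prop :=
  ∃ (a : ℕ) (δ : Bool) (q : Box.mk k ⟶ Box.mk (N + 1)), a ≤ N + 1 ∧ (a, δ) ≠ (i, ε) ∧
    p = q ≫ Box.faceN a δ ∧ y = X.act (B a δ) q

/-- A family of cubes on the faces of an open box agreeing on common faces. -/
def BoxCompatible (i : ℕ) (ε : Bool) (B : ℕ → Bool → X.cubes (N + 1)) : Prop :=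
  ∀ a b δ δ', a ≤ b → b ≤ N → (a, δ) ≠ (i, ε) → (b + 1, δ') ≠ (i, ε) →
    d a δ (B (b + 1) δ') = d b δ' (B a δ)

/-- Two faces in different directions meet in a face of codimension two: composing with degeneracies
shows that `q` and `q'` factor through it by the same map, and there the prescribed cubes agree. -/
theorem BoxCompatible.unique_aux {i : ℕ} {ε : Bool} {B : ℕ → Bool → X.cubes (N + 1)}
    (hB : BoxCompatible i ε B) {k a b : ℕ} {δ δ' : Bool} {q q' : Box.mk k ⟶ Box.mk (N + 1)}
    (hab : a ≤ b) (hb : b ≤ N) (ha : (a, δ) ≠ (i, ε)) (hb' : (b + 1, δ') ≠ (i, ε))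
    (h : q ≫ Box.faceN a δ = q' ≫ Box.faceN (b + 1) δ') :
    X.act (B a δ) q = X.act (B (b + 1) δ') q' := by
  have h1 : q = (q' ≫ Box.degN .degen a) ≫ Box.faceN b δ' := by
    have := congrArg (· ≫ Box.degN .degen a) h
    simp only [Category.assoc] at this
    rwa [Box.faceN_comp_degN_self (by omega), Category.comp_id, Box.faceN_comp_degN hab hb,
      ← Category.assoc] at this
  have h2 : q' = (q' ≫ Box.degN .degen a) ≫ Box.faceN a δ := by
    have := congrArg (· ≫ Box.degN .degen (b + 1)) h
    simp only [Category.assoc] at this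
    rw [Box.faceN_comp_degN_self (by omega), Category.comp_id, Box.faceN_comp_degN_succ hab hb,
      ← Category.assoc] at this
    refine this.symm.trans ?_
    congr 1
    rw [h1, Category.assoc, Box.faceN_comp_degN_self (by omega), Category.comp_id]
  conv_lhs => rw [h1, act_comp]
  conv_rhs => rw [h2, act_comp]
  exact congrArg (fun t => X.act t _) (hB a b δ δ' hab hb ha hb').symm

theorem BoxCompatible.unique {i : ℕ} {ε : Bool} {B : ℕ → Bool → X.cubes (N + 1)}
    (hB : BoxCompatible i ε B) {k : ℕ} {p : Box.mk k ⟶ Box.mk (N + 2)} {y y' : X.cubes k}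
    (h : IsBoxValue i ε B p y) (h' : IsBoxValue i ε B p y') : y = y' := by
  obtain ⟨a, δ, q, ha, hne, rfl, rfl⟩ := h
  obtain ⟨b, δ', q', hb, hne', h, rfl⟩ := h'
  rcases lt_trichotomy a b with hab | rfl | hab
  · obtain ⟨b, rfl⟩ : ∃ l, b = l + 1 := ⟨b - 1, by omega⟩
    exact hB.unique_aux (by omega) (by omega) hne hne' h
  -- Opposite faces are disjoint, as the coordinate `a` of a common vertex would be both `δ` and
  -- `δ'`.
  · have hδ : δ = δ' := by
      have := congrArg (fun r => coord (Box.app r fun _ => true) a) h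
      simp only [Box.coord_comp] at this
      simpa (disch := omega) [Box.coord_faceN] using this
    subst hδ
    have := congrArg (· ≫ Box.degN .degen a) h
    simp only [Category.assoc] at this
    rw [Box.faceN_comp_degN_self (by omega), Category.comp_id, Category.comp_id] at this
    rw [this]
  · obtain ⟨a, rfl⟩ : ∃ l, a = l + 1 := ⟨a - 1, by omega⟩
    exact (hB.unique_aux (by omega) (by omega) hne' hne h.symm).symm

theorem IsBoxValue.comp {i : ℕ} {ε : Bool} {B : ℕ → Bool → X.cubes (N + 1)} {k l : ℕ}
    {p : Box.mk k ⟶ Box.mk (N + 2)} {y : X.cubes k} (h : IsBoxValue i ε B p y)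
    (r : Box.mk l ⟶ Box.mk k) : IsBoxValue i ε B (r ≫ p) (X.act y r) := by
  obtain ⟨a, δ, q, ha, hne, rfl, rfl⟩ := h
  exact ⟨a, δ, r ≫ q, ha, hne, (Category.assoc _ _ _).symm, (act_comp _ _ _ _).symm⟩

theorem mem_openBox_iff {i : Fin (N + 2)} {ε : Bool} {k : ℕ} (p : Box.mk k ⟶ Box.mk (N + 2)) :
    (ULift.up p : (cube.{u} (N + 2)).cubes k) ∈ (openBox.{u} (N + 1) i ε).obj (op (Box.mk k)) ↔
      ∃ (a : Fin (N + 2)) (δ : Bool), (a, δ) ≠ (i, ε) ∧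
        ∃ q : Box.mk k ⟶ Box.mk (N + 1), q ≫ Box.face a δ = p := by
  simp only [openBox, Subfunctor.iSup_obj]
  refine Set.mem_iUnion.trans (exists_congr fun a => Set.mem_iUnion.trans
    (exists_congr fun δ => Set.mem_iUnion.trans ?_))
  rw [exists_prop]
  refine and_congr_right fun _ => ⟨?_, ?_⟩
  · rintro ⟨⟨q⟩, hq⟩
    exact ⟨q, congrArg ULift.down hq⟩
  · rintro ⟨q, rfl⟩
    exact ⟨ULift.up q, rfl⟩

theorem exists_isBoxValue {i : Fin (N + 2)} {ε : Bool} (B : ℕ → Bool → X.cubes (N + 1)) {k : ℕ}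
    {p : Box.mk k ⟶ Box.mk (N + 2)}
    (hp : (ULift.up p : (cube.{u} (N + 2)).cubes k) ∈
      (openBox.{u} (N + 1) i ε).obj (op (Box.mk k))) :
    ∃ y, IsBoxValue i.1 ε B p y := by
  rw [mem_openBox_iff] at hp
  obtain ⟨a, δ, hne, q, rfl⟩ := hp
  refine ⟨_, a.1, δ, q, by omega, ?_, by rw [Box.faceN_eq a.2], rfl⟩
  intro h
  exact hne (Prod.ext (Fin.ext (Prod.ext_iff.1 h).1) (Prod.ext_iff.1 h).2)

/-- The map on an open box given by compatible cubes on its faces. -/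
theorem BoxCompatible.exists_map {i : Fin (N + 2)} {ε : Bool} {B : ℕ → Bool → X.cubes (N + 1)}
    (hB : BoxCompatible i.1 ε B) : ∃ F : (openBox.{u} (N + 1) i ε).toFunctor ⟶ X,
      ∀ (k : ℕ) (p : Box.mk k ⟶ Box.mk (N + 2)) (hp : (ULift.up p : (cube.{u} (N + 2)).cubes k) ∈
        (openBox.{u} (N + 1) i ε).obj (op (Box.mk k))),
        IsBoxValue i.1 ε B p (F.app (op (Box.mk k)) ⟨ULift.up p, hp⟩) := by
  -- The values may be picked arbitrarily: naturality follows from their uniqueness.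
  choose v hv using fun (k : ℕ) (p : (openBox.{u} (N + 1) i ε).toFunctor.obj (op (Box.mk k))) =>
    exists_isBoxValue B p.2
  refine ⟨{ app := fun k => ↾fun p => v k.unop.dim p, naturality := ?_ }, ?_⟩
  · intro k l r
    ext p
    exact hB.unique (hv _ _) ((hv _ p).comp r.unop)
  · intro k p hp
    exact hv k ⟨ULift.up p, hp⟩

/-! ### Fillers in cubical quasicategories -/

/-- Open boxes with a face `∂_{i,0}` missing, with degenerate critical edge, can be filled in
cubical quasicategories. -/
theorem IsQuasicategory.exists_filler (hX : X.IsQuasicategory) {i : ℕ} (hi : 1 ≤ i)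
    (hiN : i ≤ N + 1) {B : ℕ → Bool → X.cubes (N + 1)} (hB : BoxCompatible i false B)
    (hc : cap 0 (B 0 true) = B 0 true) :
    ∃ z : X.cubes (N + 2), ∀ a ≤ N + 1, ∀ δ, (a, δ) ≠ (i, false) → d a δ z = B a δ := by
  let j : Fin (N + 2) := ⟨i, by omega⟩
  obtain ⟨F, hF⟩ := BoxCompatible.exists_map (i := j) hB
  -- On the critical edge all coordinates except `i` are 1. As `1 ≤ i`, the edge lies in the face
  -- where coordinate 0 is 1, which is constant by `hc`, so the map descends to the inner open box.
  have hcrit : ∃ p : X.cubes 0,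
      toPoint (cube.{u} 1) ≫ ofCube p = critEdgeBox.{u} N j false ≫ F := by
    let c : Box.mk 1 ⟶ Box.mk (N + 2) := ⟨critMap (N + 1) j false, isBoxMap_critMap _ _ _⟩
    let r : Box.mk 1 ⟶ Box.mk (N + 1) := c ≫ Box.degN .degen 0
    have hcr : c = r ≫ Box.faceN 0 true := by
      refine Box.hom_ext fun v l => ?_
      rw [Box.comp_val, Box.comp_val, Box.faceN_eq (by omega), Box.degN_degen_eq (by omega)]
      change critMap (N + 1) j false v l =
        faceMap ⟨0, by omega⟩ true (degenMap ⟨0, by omega⟩ (critMap (N + 1) j false v)) l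
      simp only [faceMap_apply, degenMap_apply, critMap_apply, Fin.ext_iff]
      grind
    have hval : F.app (op (Box.mk 1)) ⟨ULift.up c, critEdge_mem N j false _ ⟨ULift.up (𝟙 _), by
        exact congrArg ULift.up (Category.id_comp (X := Box.mk 1) (Y := Box.mk (N + 2)) c)⟩⟩ = X.act (B 0 true) r :=
      hB.unique (hF 1 c _) ⟨0, true, r, by omega, by simp, hcr, rfl⟩
    refine ⟨X.act (B 0 true) (Box.faceN 0 true ≫ r), ?_⟩
    refine uliftYonedaEquiv.{u}.injective ?_
    have h2 : uliftYonedaEquiv.{u} (toPoint (cube.{u} 1) ≫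
        ofCube (X.act (B 0 true) (Box.faceN 0 true ≫ r))) =
        X.act (X.act (B 0 true) (Box.faceN 0 true ≫ r)) (Box.toZero _) := by
      rw [uliftYonedaEquiv_comp]
      rfl
    have h3 : uliftYonedaEquiv.{u} (critEdgeBox.{u} N j false ≫ F) = X.act (B 0 true) r := by
      rw [← hval, uliftYonedaEquiv_comp]
      congr 1
    rw [h2, h3, ← hc, cap, ← act_comp, ← act_comp, ← act_comp]
    refine congrArg _ (Box.hom_ext_coord fun v l => ?_)
    simp only [Box.coord_comp, Box.coord_raise]
    by_cases hl : l < N + 1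
    · simp [hl]
    · rw [if_neg (by omega), if_neg (by omega), Box.coord_of_le _ (by omega),
        Box.coord_of_le _ (by omega)]
  obtain ⟨p, hp⟩ := hcrit
  let D : innerOpenBox.{u} N j false ⟶ X := pushout.desc (ofCube p) F hp
  have sq : CommSq D (innerOpenBoxIncl.{u} N j false) (toPoint X) (toPoint _) :=
    ⟨toPoint_eq _ _⟩
  have := hX N j false
  let L := sq.lift
  have hL : (openBox.{u} (N + 1) j false).ι ≫
      pushout.inr (toPoint (cube 1)) (critEdge (N + 1) j false) ≫ L = F := by
    have h1 : innerOpenBoxIncl.{u} N j false ≫ L = D := sq.fac_left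
    have h2 : pushout.inr _ _ ≫ innerOpenBoxIncl.{u} N j false =
        (openBox.{u} (N + 1) j false).ι ≫
          pushout.inr (toPoint (cube 1)) (critEdge (N + 1) j false) := by
      exact pushout.inr_desc _ _ _
    refine (Category.assoc _ _ _).symm.trans ?_
    refine (congrArg (· ≫ L) h2.symm).trans ((Category.assoc _ _ _).trans ?_)
    exact (congrArg (pushout.inr _ _ ≫ ·) h1).trans (pushout.inr_desc _ _ _)
  refine ⟨toCube (pushout.inr (toPoint (cube 1)) (critEdge (N + 1) j false) ≫ L),
    fun a ha δ hne => ?_⟩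
  have hmem : (ULift.up (Box.faceN a δ) : (cube.{u} (N + 2)).cubes (N + 1)) ∈
      (openBox.{u} (N + 1) j false).obj (op (Box.mk (N + 1))) := by
    rw [mem_openBox_iff]
    refine ⟨⟨a, by omega⟩, δ, fun h => hne ?_, 𝟙 _, ?_⟩
    · have h1 := congrArg (fun t => t.1.1) h
      have h2 := congrArg Prod.snd h
      exact Prod.ext h1 h2
    · rw [Category.id_comp, Box.faceN_eq]
  have h1 : F.app (op (Box.mk (N + 1))) ⟨ULift.up (Box.faceN a δ), hmem⟩ = B a δ :=
    hB.unique (hF _ _ hmem) ⟨a, δ, 𝟙 _, ha, hne, (Category.id_comp _).symm, (act_id _ _).symm⟩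
  rw [← h1, ← hL]
  change X.act (toCube _) _ = _
  rw [toCube, act, uliftYonedaEquiv_naturality]
  rw [uliftYonedaEquiv_comp, uliftYonedaEquiv_uliftYoneda_map]
  rfl

theorem e_d_cap {i j k : ℕ} (hij : i ≤ j) (hik : i ≤ k) (hj : j ≤ N) (hk : k ≤ N) (τ : Shape)
    (ε : Bool) (x : X.cubes (N + 1)) : e τ j (d k ε (cap i x)) = cap i x := by
  rw [d_cap_of_ge hik hik hk hk, e_cap τ .degen hij hik hj hk, ← cap_e_of_le _ hik hk,
    ← top_eq hk]
  refine act_congr_left fun v l => ?_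
  simp (disch := omega) only [Box.coord_raise, decide_eq_true_eq]
  grind

/-- Partial boundaries of cubes lacking the faces `∂_{a,0}` for `n ≤ a ≤ n + r` can be filled in
cubical quasicategories. -/
theorem IsQuasicategory.exists_filler_of_partial (hX : X.IsQuasicategory) (r : ℕ) :
    ∀ {N n k : ℕ} {B : ℕ → Bool → X.cubes (N + 1)}, 1 ≤ n → k = n + r → k ≤ N + 1 →
      (∀ a b δ δ', a ≤ b → b ≤ N → (δ = true ∨ a < n ∨ k < a) →
        (δ' = true ∨ b + 1 < n ∨ k < b + 1) → d a δ (B (b + 1) δ') = d b δ' (B a δ)) →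
      cap 0 (B 0 true) = B 0 true →
      ∃ z : X.cubes (N + 2), ∀ a ≤ N + 1, ∀ δ, (δ = true ∨ a < n ∨ k < a) → d a δ z = B a δ := by
  induction r with
  | zero =>
    intro N n k B hn hk hkN hB hc
    have hne : ∀ {a : ℕ} {δ : Bool}, (a, δ) ≠ (n, false) ↔ (δ = true ∨ a < n ∨ k < a) := by
      intro a δ
      rw [ne_eq, Prod.mk.injEq]
      cases δ
      · simp
        omega
      · simp
    obtain ⟨z, hz⟩ := hX.exists_filler (i := n) hn (by omega) (B := B)
      (fun a b δ δ' hab hb h h' => hB a b δ δ' hab hb (hne.1 h) (hne.1 h')) hc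
    exact ⟨z, fun a ha δ h => hz a ha δ (hne.2 h)⟩
  | succ r ih =>
    intro N n k B hn hk hkN hB hc
    obtain ⟨N, rfl⟩ : ∃ l, N = l + 1 := ⟨N - 1, by omega⟩
    obtain ⟨k, rfl⟩ : ∃ l, k = l + 1 := ⟨k - 1, by omega⟩
    -- First the missing face in direction `k + 1` is constructed. Its own boundary is read off from
    -- the given faces, with indices beyond `k` shifted by one, and lacks only directions `n` to
    -- `k`.
    obtain ⟨y, hy⟩ := ih (N := N) (n := n) (k := k)
      (B := fun a δ => if a ≤ k then d k false (B a δ) else d (k + 1) false (B (a + 1) δ))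
      hn (by omega) (by omega) (by
        intro a b δ δ' hab hb h h'
        by_cases hbk : b + 1 ≤ k
        · rw [if_pos hbk, if_pos (by omega)]
          obtain ⟨k, rfl⟩ : ∃ l, k = l + 1 := ⟨k - 1, by omega⟩
          rw [d_d (by omega) (by omega), d_d (by omega) (by omega),
            hB a b δ δ' hab (by omega)
            (h.imp_right fun h => by omega) (h'.imp_right fun h => by omega)]
        · rw [if_neg hbk]
          by_cases hak : a ≤ k
          · rw [if_pos hak, d_d (by omega) (by omega), ← d_d (i := k) (j := b) (by omega) (by omega),
              hB a (b + 1) δ δ' (by omega) (by omega)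
              (h.imp_right fun h => by omega) (h'.imp_right fun h => by omega)]
          · rw [if_neg hak, ← d_d (by omega) (by omega),
              ← d_d (i := k + 1) (j := b) (by omega) (by omega),
              hB (a + 1) (b + 1) δ δ' (by omega) (by omega)
              (h.imp_right fun h => by omega) (h'.imp_right fun h => by omega)])
      (by
        rw [if_pos (by omega), ← hc, d_cap_of_ge (Nat.zero_le _) (Nat.zero_le 0) (by omega)
          (by omega), cap_cap, min_self])
    -- With `y` added to the boundary, one missing face fewer remains. As `n` never changes, every
    -- box eventually filled lacks the face in direction `n`.
    obtain ⟨z, hz⟩ := ih (N := N + 1) (n := n) (k := k)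
      (B := fun a δ => if a = k + 1 ∧ δ = false then y else B a δ) hn (by omega) (by omega) (by
        intro a b δ δ' hab hb h h'
        by_cases hbk : b + 1 = k + 1 ∧ δ' = false
        · obtain ⟨hbk, rfl⟩ := hbk
          obtain rfl : b = k := by omega
          rw [if_pos ⟨rfl, rfl⟩, if_neg (by omega), hy a (by omega) δ h, if_pos hab]
        · rw [if_neg hbk]
          by_cases hak : a = k + 1 ∧ δ = false
          · obtain ⟨rfl, rfl⟩ := hak
            rw [if_pos ⟨rfl, rfl⟩, hy b (by omega) δ' (h'.imp_right fun h => by omega), if_neg (by omega)]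
          · rw [if_neg hak]
            refine hB a b δ δ' hab hb ?_ ?_
            · cases δ <;> simp at h hak ⊢; omega
            · cases δ' <;> simp at h' hbk ⊢; omega)
      (by
        rw [if_neg (by omega), hc])
    refine ⟨z, fun a ha δ h => ?_⟩
    have := hz a ha δ (h.imp_right fun h => by omega)
    rwa [if_neg] at this
    rintro ⟨rfl, rfl⟩
    simp at h
    omega

/-! ### Inductive step: values obtained by filling -/

section Step

variable {f : ℕ → X.cubes N → X.cubes (N + 1)} {g : ℕ → X.cubes (N + 1) → X.cubes (N + 2)}
  {n : ℕ} {x : X.cubes (N + 2)}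

/-- The prescribed faces of `θ(x)`. -/
def thetaBoundary (g : ℕ → X.cubes (N + 1) → X.cubes (N + 2)) (n : ℕ) (x : X.cubes (N + 2))
    (a : ℕ) : Bool → X.cubes (N + 2)
  | true => if a ≤ n then cap a x else g n (d (a - 1) true x)
  | false => if a < n then g (n - 1) (d a false x) else x

/-- Two values of θ are compared by `Rel` one dimension lower, a value of θ with `x` or a cap by
`Base`, and caps with each other or with `x` by the cone condition on `x`. -/
theorem thetaBoundary_compatible (hg : Base g) (hfg : Rel f g) (hn : n ≤ N) (hx : IsCone n x)
    {a b : ℕ} {δ δ' : Bool} (hab : a ≤ b) (hb : b ≤ N + 1) (ha : δ = true ∨ a ≤ n)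
    (hb' : δ' = true ∨ b + 1 ≤ n) :
    d a δ (thetaBoundary g n x (b + 1) δ') = d b δ' (thetaBoundary g n x a δ) := by
  have hc0 : ∀ m i, n = m + 1 → i ≤ m → IsCone m (d i false x) := fun m i hm hi =>
    hx.d (by omega) (by omega) (by omega) _
  have hc1 : ∀ i, n ≤ i → i ≤ N + 1 → IsCone n (d i true x) := fun i hi hiN =>
    hx.d (by omega) (by omega) (by omega) _
  cases δ <;> cases δ' <;> simp only [thetaBoundary, Bool.false_eq_true, false_or] at ha hb' ⊢
  · obtain ⟨n, rfl⟩ : ∃ m, n = m + 1 := ⟨n - 1, by omega⟩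
    rw [if_pos (show a < n + 1 by omega), Nat.add_sub_cancel]
    by_cases hbn : b + 1 < n + 1
    · obtain ⟨n, rfl⟩ : ∃ m, n = m + 1 := ⟨n - 1, by omega⟩
      rw [if_pos hbn, (hfg _ (by omega) _ (hc0 _ _ rfl (by omega))).zero n rfl a (by omega),
        (hfg _ (by omega) _ (hc0 _ _ rfl (by omega))).zero n rfl b (by omega),
        d_d hab (by omega)]
    · obtain rfl : b = n := by omega
      rw [if_neg hbn, (hg _ (by omega) _ (hc0 _ _ rfl (by omega))).self]
  · by_cases hbn : b + 1 ≤ n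
    · obtain ⟨n, rfl⟩ : ∃ m, n = m + 1 := ⟨n - 1, by omega⟩
      rw [if_pos hbn, if_pos (by omega), Nat.add_sub_cancel, d_cap_of_le hab (by omega),
        (hg _ (by omega) _ (hc0 _ _ rfl (by omega))).one _ (by omega)]
    · rw [if_neg hbn, Nat.add_sub_cancel]
      by_cases han : a < n
      · obtain ⟨n, rfl⟩ : ∃ m, n = m + 1 := ⟨n - 1, by omega⟩
        obtain ⟨b, rfl⟩ : ∃ l, b = l + 1 := ⟨b - 1, by omega⟩
        rw [if_pos han, Nat.add_sub_cancel,
          (hfg _ (by omega) _ (hc1 _ (by omega) (by omega))).zero n rfl a (by omega),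
          (hfg _ (by omega) _ (hc0 _ _ rfl (by omega))).one b (by omega) (by omega),
          d_d (by omega) (by omega)]
      · obtain rfl : a = n := by omega
        rw [if_neg han, (hg _ (by omega) _ (hc1 _ (by omega) (by omega))).self]
  · rw [if_pos (show a ≤ n by omega), d_cap_of_ge (k := a) hab le_rfl (by omega) (by omega),
      hx.cap_d (by omega) (by omega)]
    by_cases hbn : b + 1 < n
    · obtain ⟨n, rfl⟩ : ∃ m, n = m + 1 := ⟨n - 1, by omega⟩
      have hc := hc0 n (b + 1) rfl (by omega)
      rw [if_pos hbn, Nat.add_sub_cancel, (hg _ (by omega) _ hc).one _ (by omega),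
        ← hc.degen_d (by omega) (by omega), d_d hab (by omega), ← hx.cap_d (by omega) (by omega),
        e_d_cap le_rfl hab (by omega) (by omega)]
    · rw [if_neg hbn]
  · by_cases hbn : b + 1 ≤ n
    · rw [if_pos hbn, if_pos (by omega), d_cap_of_le hab (by omega),
        d_cap_of_ge (k := a) hab le_rfl (by omega) (by omega),
        ← hx.cap_d (i := a) (by omega) (by omega), cap_cap, cap_cap, min_self, min_eq_right hab]
    · rw [if_neg hbn, Nat.add_sub_cancel]
      by_cases han : a ≤ n
      · rw [if_pos han, (hg _ (by omega) _ (hc1 _ (by omega) (by omega))).one _ han,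
          d_cap_of_ge (k := b) hab hab (by omega) (by omega)]
      · obtain ⟨a, rfl⟩ : ∃ l, a = l + 1 := ⟨a - 1, by omega⟩
        obtain ⟨b, rfl⟩ : ∃ l, b = l + 1 := ⟨b - 1, by omega⟩
        rw [if_neg han, Nat.add_sub_cancel,
          (hfg _ (by omega) _ (hc1 _ (by omega) (by omega))).one _ (by omega) (by omega),
          (hfg _ (by omega) _ (hc1 _ (by omega) (by omega))).one _ (by omega) (by omega),
          d_d (by omega) (by omega)]

theorem exists_theta_of_filler (hX : X.IsQuasicategory) (hg : Base g) (hfg : Rel f g) (hn : n ≤ N)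
    (hx : IsCone n x) :
    ∃ z : X.cubes (N + 3), d n false z = x ∧ (∀ i ≤ n, d i true z = cap i x) ∧
      (∀ k, n = k + 1 → ∀ i ≤ k, d i false z = g k (d i false x)) ∧
      (∀ i, n ≤ i → i ≤ N + 1 → d (i + 1) true z = g n (d i true x)) := by
  -- The unprescribed faces are those at 0 in the directions after the new coordinate, `n + 1` to `N
  -- + 2`. The face in direction 0 at 1 is `cap 0 x`, which is constant.
  obtain ⟨z, hz⟩ := hX.exists_filler_of_partial (N + 1 - n) (N := N + 1) (n := n + 1) (k := N + 2)
    (B := thetaBoundary g n x) (by omega) (by omega) (by omega)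
    (fun a b δ δ' hab hb ha hb' => thetaBoundary_compatible hg hfg hn hx hab hb
      (ha.imp_right fun h => by omega) (hb'.imp_right fun h => by omega))
    (by simp only [thetaBoundary, Nat.zero_le, if_true, cap_cap, min_self])
  refine ⟨z, ?_, fun i hi => ?_, ?_, fun i hi hiN => ?_⟩
  · rw [hz n (by omega) false (by omega)]
    simp [thetaBoundary]
  · rw [hz i (by omega) true (by simp)]
    simp [thetaBoundary, hi]
  · rintro k rfl i hi
    rw [hz i (by omega) false (by omega)]
    simp [thetaBoundary, Nat.lt_succ_of_le hi]
  · rw [hz (i + 1) (by omega) true (by simp)]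
    simp [thetaBoundary, Nat.not_le.2 (Nat.lt_succ_of_le hi)]

/-- At most one coordinate follows the first `n`, and raising the last coordinate is the same as
raising everything from it on. So filling is needed only when at least two coordinates follow the
cone coordinates. -/
theorem isCone_succ_of_le {n : ℕ} {x : X.cubes (N + 1)} (hn : N ≤ n) (hx : IsCone n x) :
    IsCone (n + 1) x := by
  rw [isCone_iff] at hx ⊢
  intro i hi hiN
  rcases hiN.lt_or_eq with h | rfl
  · exact hx i (by omega) hiN
  · exact cap_of_le le_rfl _

/-- The order of the cases matters: after the first two, the clauses `cone` and `self` are vacuous,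
and filling has only the face conditions and `cap` to meet. -/
theorem exists_theta (hX : X.IsQuasicategory) (hg : Base g) (hfg : Rel f g) (hn : n ≤ N + 2)
    (hx : IsCone n x) : ∃ z, BaseAt n x z ∧ RelAt g n x z := by
  by_cases h1 : IsCone (n + 1) x
  · exact ⟨_, baseAt_conn hn hx h1, relAt_conn hg hn h1⟩
  by_cases h2 : ∃ k y, n = k + 1 ∧ IsCone k y ∧ x = g k y
  · obtain ⟨k, y, rfl, hy, h2⟩ := h2
    exact ⟨_, baseAt_self hg (by omega) hy hx h1 h2, relAt_self hg hfg (by omega) hy h2⟩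
  have h2' : ∀ k y, n = k + 1 → IsCone k y → x ≠ g k y := fun k y hk hy h =>
    h2 ⟨k, y, hk, hy, h⟩
  by_cases h3 : ∃ (τ : Shape) (i : ℕ) (y : X.cubes (N + 1)), n ≤ i ∧ i + τ.width ≤ N + 2 ∧
      IsCone n y ∧ x = e τ i y
  · obtain ⟨τ, i, y, hi, hiN, hy, h3⟩ := h3
    exact ⟨_, baseAt_hi hg hi hiN hy h3 h1, relAt_hi hfg hi hiN hy h3 h2'⟩
  by_cases h4 : ∃ (k i : ℕ) (y : X.cubes (N + 1)), n = k + 1 ∧ i < k ∧ IsCone k y ∧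
      x = e (.conn false) i y
  · obtain ⟨k, i, y, rfl, hi, hy, h4⟩ := h4
    exact ⟨_, baseAt_lo hg hi (by omega) hy h4 h1, relAt_lo hfg hi (by omega) hy h4 h2'⟩
  have hnN : n ≤ N := by
    by_contra hnN
    exact h1 (isCone_succ_of_le (by omega) hx)
  obtain ⟨z, hz1, hz2, hz3, hz4⟩ := exists_theta_of_filler hX hg hfg hnN hx
  refine ⟨z, ⟨hz1, hz2, ?_, fun h => absurd h h1⟩, ⟨hz3, hz4, ?_, ?_, ?_⟩⟩
  -- The clause `cap` was not prescribed to the filler. But `cap (n + 1) z` is determined by its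
  -- face in direction `n + 1` at 1, which comes from a lower value of θ, where the clause is known.
  · have hc : IsCone n (d n true x) := hx.d (by omega) (by omega) (by omega) _
    rw [← e_d_cap (k := n + 1) le_rfl le_rfl (by omega) (by omega) .degen true z,
      d_cap_of_ge le_rfl le_rfl (by omega) (by omega), hz4 n le_rfl (by omega),
      (hg n (by omega) _ hc).cap, ← e_d_cap (k := n) le_rfl le_rfl (by omega) (by omega) .degen
      true x, d_cap_of_ge le_rfl le_rfl (by omega) (by omega), e_e (i := n) _ _ (by simp)
      (by omega)]
  · exact fun τ i y hi hiN hy h => absurd ⟨τ, i, y, hi, hiN, hy, h⟩ h3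
  · exact fun k i y hk hi hy h => absurd ⟨k, i, y, hk, hi, hy, h⟩ h4
  · exact fun k y hk hy h => absurd h (h2' k y hk hy)

end Step

/-! ### The recursion -/

open Classical in
/-- The coherent family of composites, on underlying cubes. -/
noncomputable def theta (X : CSet.{u}) : ∀ N : ℕ, ℕ → X.cubes N → X.cubes (N + 1)
  | 0, _, x => e .degen 0 x
  | N + 1, n, x =>
    -- The default value is irrelevant: on the cones in the range of `Base` and `Rel` the existence
    -- statement always holds.
    if h : ∃ z, BaseAt n x z ∧ RelAt (theta X N) n x z then h.choose else e .degen 0 x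

theorem base_theta_zero (X : CSet.{u}) : Base (theta X 0) := by
  intro n hn x hx
  obtain rfl : n = 0 := by omega
  refine ⟨d_degen_self le_rfl _ _, fun i hi => ?_, ?_, fun _ => ?_⟩
  · obtain rfl : i = 0 := by omega
    rw [cap_of_le le_rfl]
    exact d_degen_self le_rfl _ _
  · rw [cap_of_le le_rfl, cap_of_le le_rfl]
    rfl
  · rw [← cap_of_le le_rfl x]
    exact e_cap _ _ le_rfl le_rfl le_rfl le_rfl _

theorem theta_spec {n : ℕ} {x : X.cubes (N + 1)}
    (h : ∃ z, BaseAt n x z ∧ RelAt (theta X N) n x z) :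
    BaseAt n x (theta X (N + 1) n x) ∧ RelAt (theta X N) n x (theta X (N + 1) n x) := by
  rw [theta, dif_pos h]
  exact h.choose_spec

theorem base_theta_and_rel_theta (hX : X.IsQuasicategory) (N : ℕ) :
    Base (theta X N) ∧ Base (theta X (N + 1)) ∧ Rel (theta X N) (theta X (N + 1)) := by
  induction N with
  | zero =>
    -- In dimension 1 every `n`-cone is an `(n+1)`-cone, so no filling is needed to start the
    -- induction.
    have key : ∀ n ≤ 1, ∀ x : X.cubes 1, IsCone n x →
        BaseAt n x (theta X 1 n x) ∧ RelAt (theta X 0) n x (theta X 1 n x) := by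
      intro n hn x hx
      have h := isCone_succ_of_le (Nat.zero_le n) hx
      exact theta_spec ⟨_, baseAt_conn hn hx h, relAt_conn (base_theta_zero X) hn h⟩
    exact ⟨base_theta_zero X, fun n hn x hx => (key n hn x hx).1,
      fun n hn x hx => (key n hn x hx).2⟩
  | succ N ih =>
    have key : ∀ n ≤ N + 2, ∀ x : X.cubes (N + 2), IsCone n x →
        BaseAt n x (theta X (N + 2) n x) ∧ RelAt (theta X (N + 1)) n x (theta X (N + 2) n x) :=
      fun n hn x hx => theta_spec (exists_theta hX ih.2.1 ih.2.2 hn hx)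
    exact ⟨ih.2.1, fun n hn x hx => (key n hn x hx).1, fun n hn x hx => (key n hn x hx).2⟩

end CSet

/-! ### Standard cones and the path object -/

namespace Box
theorem coord_cast {a b : ℕ} (h : a = b) (v : Vert a) (j : ℕ) :
    coord (app (Box.cast h) v) j = coord v j := by
  subst h
  rfl

theorem coord_prod_of_lt {a b c d : ℕ} (f : Box.mk a ⟶ Box.mk b) (g : Box.mk c ⟶ Box.mk d)
    (v : Vert (a + c)) {j : ℕ} (hj : j < b) :
    coord (app (prod f g) v) j = coord (app f fun i => v ⟨i.1, by omega⟩) j := by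
  change coord (prodMap f.1 g.1 v) j = _
  unfold coord
  rw [dif_pos (show j < b + d by omega), dif_pos hj, prodMap_apply, dif_pos hj]
  rfl

theorem coord_prod_of_le {a b c d : ℕ} (f : Box.mk a ⟶ Box.mk b) (g : Box.mk c ⟶ Box.mk d)
    (v : Vert (a + c)) {j : ℕ} (hj : b ≤ j) :
    coord (app (prod f g) v) j = coord (app g fun i => v ⟨a + i.1, by omega⟩) (j - b) := by
  change coord (prodMap f.1 g.1 v) j = _
  unfold coord
  by_cases h : j < b + d
  · rw [dif_pos h, dif_pos (by omega), prodMap_apply, dif_neg (by simpa using hj)]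
    rfl
  · rw [dif_neg h, dif_neg (by omega)]

theorem coord_right {a c : ℕ} (v : Vert (a + c)) (j : ℕ) :
    coord (fun i : Fin c => v ⟨a + i.1, by omega⟩) j = coord v (a + j) := by
  unfold coord
  by_cases h : j < c
  · rw [dif_pos h, dif_pos (by omega)]
  · rw [dif_neg h, dif_neg (by omega)]

theorem coord_left {a c : ℕ} (v : Vert (a + c)) {j : ℕ} (hj : j < a) :
    coord (fun i : Fin a => v ⟨i.1, by omega⟩) j = coord v j := by
  unfold coord
  rw [dif_pos hj, dif_pos (by omega)]

theorem coord_id {a : ℕ} (v : Vert a) (j : ℕ) : coord (app (𝟙 (Box.mk a)) v) j = coord v j := rfl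

theorem prod_id_raise {N : ℕ} (p : ℕ → Bool) :
    prod (𝟙 (Box.mk 1)) (raise (n := N) p) = raise fun j => decide (1 ≤ j) && p (j - 1) := by
  refine hom_ext_coord fun v j => ?_
  rw [coord_raise]
  by_cases hj : j < 1
  · rw [coord_prod_of_lt _ _ _ hj, coord_id, coord_left _ hj]
    simp [hj]
  · rw [coord_prod_of_le _ _ _ (Nat.not_lt.1 hj), coord_raise, coord_right]
    have h1 : 1 + (j - 1) = j := by omega
    have h2 : 1 ≤ j := by omega
    have h3 : j - 1 < N ↔ j < 1 + N := by omega
    simp only [h1, h2, h3, decide_true, Bool.true_and]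

/-- The inclusion of the end `{1} ⊗ [1]ⁿ` of `[1]¹⁺ⁿ`. -/
def endMap (n : ℕ) : Box.mk n ⟶ Box.mk (1 + n) :=
  cast (Nat.zero_add n).symm ≫ prod (face 0 true) (𝟙 (Box.mk n))

theorem coord_endMap {n : ℕ} (v : Vert n) (j : ℕ) :
    coord (app (endMap n) v) j = if j = 0 then true else coord v (j - 1) := by
  unfold endMap
  rw [coord_comp]
  by_cases hj : j < 1
  · obtain rfl : j = 0 := by omega
    rw [coord_prod_of_lt _ _ _ hj, ← faceN_eq (by omega), coord_faceN (by omega)]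
    rfl
  · rw [coord_prod_of_le _ _ _ (Nat.not_lt.1 hj), coord_id, coord_right, coord_cast,
      if_neg (by omega), Nat.zero_add]

theorem nonempty_vertex (n : ℕ) : Nonempty (Box.mk 0 ⟶ Box.mk n) := by
  induction n with
  | zero => exact ⟨𝟙 _⟩
  | succ n ih => exact ih.map fun p => p ≫ Box.face 0 false

end Box

namespace CSet

variable {X Y : CSet.{u}}

/-- The path object, with `n`-cubes the `(1 + n)`-cubes of `X`. -/
def path (X : CSet.{u}) : CSet.{u} where
  obj k := X.obj (op (Box.mk (1 + k.unop.dim)))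
  map f := X.map (Box.prod (𝟙 (Box.mk 1)) f.unop).op
  map_id k := by
    have : Box.prod (𝟙 (Box.mk 1)) (𝟙 k : k ⟶ k).unop = 𝟙 _ := Box.prod_id 1 k.unop.dim
    rw [this]
    exact X.map_id _
  map_comp f g := by
    rw [← X.map_comp, ← op_comp, ← Box.prod_comp, Category.id_comp]
    rfl

/-- The map `Y → path X` corresponding to a map `□¹ ⊗ Y → X`. -/
def curry (G : tensor (cube.{u} 1) Y ⟶ X) : Y ⟶ path X where
  app k := ↾fun y => G.app (op (Box.mk (1 + k.unop.dim)))
    (tensorMk (n := k.unop.dim) (ULift.up (𝟙 (Box.mk 1))) y (𝟙 _))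
  naturality k l f := by
    ext y
    obtain ⟨⟨k⟩⟩ := k
    obtain ⟨⟨l⟩⟩ := l
    have h := Quot.sound (TensorRel.mk (X := cube.{u} 1) (Y := Y) (k := Box.mk (1 + l))
      (ULift.up (𝟙 (Box.mk 1))) y (𝟙 _) f.unop (𝟙 _))
    have h' := map_act G (n := 1 + k) (k := 1 + l)
      (tensorMk (n := k) (ULift.up (𝟙 (Box.mk 1))) y (𝟙 _)) (Box.prod (𝟙 _) f.unop)
    refine Eq.trans (congrArg (G.app (op (Box.mk (1 + l)))) (h.trans ?_)) h'
    refine congrArg (fun e => Quot.mk _ (TensorPre.mk 1 k _ y e)) ?_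
    exact (Category.id_comp _).trans (Category.comp_id _).symm

/-- The map `□¹ ⊗ Y → X` corresponding to a map `Y → path X`. -/
def uncurry (F : Y ⟶ path X) : tensor (cube.{u} 1) Y ⟶ X where
  app k := ↾Quot.lift (fun t => X.map (t.h ≫ Box.prod (t.x : ULift (Box.mk t.m ⟶ Box.mk 1)).down
      (𝟙 (Box.mk t.n))).op (F.app (op (Box.mk t.n)) t.y : X.cubes (1 + t.n))) (by
    rintro _ _ @⟨m, n, m', n', ⟨x⟩, y, p, q, h⟩
    have h1 : F.app _ (Y.act y q) = X.act (n := 1 + n) (k := 1 + n') (F.app (op (Box.mk n)) y)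
      (Box.prod (𝟙 _) q) := map_act F y q
    dsimp only
    refine (congrArg _ h1).trans ?_
    refine (act_comp X (n := 1 + n) _ _ _).symm.trans ?_
    refine congrArg (X.act (n := 1 + n) (F.app (op (Box.mk n)) y)) ?_
    change (h ≫ Box.prod (p ≫ x) (𝟙 _)) ≫ Box.prod (𝟙 _) q =
      (h ≫ Box.prod p q) ≫ Box.prod x (𝟙 _)
    rw [Category.assoc, Category.assoc, ← Box.prod_comp, ← Box.prod_comp, Category.comp_id,
      Category.comp_id, Category.id_comp])
  naturality k l f := by
    ext t
    induction t using Quot.ind with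
    | mk t =>
      change X.map ((f.unop ≫ t.h) ≫ _).op _ = X.map f (X.map (t.h ≫ _).op _)
      rw [Category.assoc, op_comp, X.map_comp]
      rfl

theorem uncurry_tensorMk (F : Y ⟶ path X) {k : Box} {m n : ℕ} (p : Box.mk m ⟶ Box.mk 1)
    (y : Y.cubes n) (h : k ⟶ Box.mk (m + n)) :
    (uncurry F).app (op k) (tensorMk (ULift.up p) y h) =
      X.act (n := 1 + n) (F.app (op (Box.mk n)) y) (h ≫ Box.prod p (𝟙 (Box.mk n))) := rfl

theorem endIncl_app {n : ℕ} (y : Y.cubes n) :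
    (endIncl Y).app (op (Box.mk n)) y =
      (tensor (cube.{u} 1) Y).act (n := 1 + n)
        (tensorMk (ULift.up (𝟙 (Box.mk 1))) y (𝟙 (Box.mk (1 + n)))) (Box.endMap n) := by
  have h := Quot.sound (TensorRel.mk (X := cube.{u} 1) (Y := Y) (k := Box.mk n)
      (ULift.up (𝟙 (Box.mk 1))) y (Box.face 0 true) (𝟙 _) (Box.cast (Nat.zero_add n).symm))
  have h1 : (cube.{u} 1).act (ULift.up (𝟙 (Box.mk 1))) (Box.face 0 true) =
      ULift.up (Box.face 0 true) :=
    congrArg ULift.up (Category.comp_id (X := Box.mk 0) (Y := Box.mk 1) (Box.face 0 true))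
  rw [h1, act_id] at h
  refine Eq.trans ?_ (h.trans ?_)
  · refine congrArg (fun e => Quot.mk _ (TensorPre.mk 0 n e y _)) ?_
    exact congrArg ULift.up
      (Category.id_comp (X := Box.mk 0) (Y := Box.mk 1) (Box.face 0 true))
  · exact congrArg (fun e => Quot.mk _ (TensorPre.mk 1 n _ y e)) (Category.comp_id _).symm

theorem isCone_path_iff {n N : ℕ} (x : X.cubes (1 + N)) :
    IsCone (X := path X) (N := N) n x ↔ ∀ i < n, top (i + 1) x = cap (i + 1) x := by
  have h1 : ∀ i, top (X := path X) (N := N) i x = top (i + 1) x := fun i => by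
    refine (congrArg (X.act x) (Box.prod_id_raise _)).trans ?_
    rw [top]
    congr 2
    funext j
    rw [← Bool.decide_and]
    exact decide_eq_decide.2 (by omega)
  have h2 : ∀ i, cap (X := path X) (N := N) i x = cap (i + 1) x := fun i => by
    refine (congrArg (X.act x) (Box.prod_id_raise _)).trans ?_
    rw [cap]
    congr 2
    funext j
    rw [← Bool.decide_and]
    exact decide_eq_decide.2 (by omega)
  refine forall_congr' fun i => forall_congr' fun _ => ?_
  exact Eq.congr (h1 i) (h2 i)

/-- The cube `top 0 x` is pulled back from the end of `x` at 1, and `cap 0 x` is constant at the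
terminal vertex of that end. They agree exactly when the end is constant. -/
theorem top_zero_eq_cap_zero_iff {N : ℕ} (x : X.cubes (1 + N)) :
    top 0 x = cap 0 x ↔ ∃ p : X.cubes 0, X.act x (Box.endMap N) = X.act p (Box.toZero _) := by
  constructor
  · intro h
    obtain ⟨w⟩ := Box.nonempty_vertex N
    refine ⟨X.act x (w ≫ Box.endMap N), ?_⟩
    have h1 : ∀ {k : ℕ} (q : Box.mk k ⟶ Box.mk N), X.act x (q ≫ Box.endMap N) =
        X.act (cap 0 x) (q ≫ Box.endMap N) := fun q => by
      rw [← h]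
      refine (act_congr_left fun v l => ?_).symm
      simp only [Box.coord_comp, Box.coord_raise, Box.coord_endMap, decide_eq_true_eq]
      grind
    rw [← act_comp, ← Category.assoc, h1, ← Category.id_comp (Box.endMap N), h1, Category.id_comp]
    refine act_congr fun v l => ?_
    simp only [Box.coord_comp, Box.coord_raise, Box.coord_endMap, decide_eq_true_eq]
    by_cases hl : l < 1 + N
    · simp [hl]
    · rw [if_neg (by omega), if_neg (by omega), if_neg (by omega), if_neg (by omega),
        Box.coord_of_le _ (by omega), Box.coord_of_le _ (by omega)]
  · rintro ⟨p, hp⟩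
    have h1 : ∀ q : Box.mk (1 + N) ⟶ Box.mk N,
        X.act x (q ≫ Box.endMap N) = X.act p (Box.toZero _) := fun q => by
      rw [act_comp, hp, ← act_comp]
      exact congrArg _ (Box.toZero_eq _ _)
    let s : Box.mk (1 + N) ⟶ Box.mk N := Box.cast (Nat.add_comm 1 N) ≫ Box.degN .degen 0
    have h2 : top 0 x = X.act x (s ≫ Box.endMap N) := by
      refine congrArg _ (Box.hom_ext_coord fun v l => ?_)
      simp (disch := omega) only [s, Box.coord_comp, Box.coord_raise, Box.coord_endMap,
        Box.coord_degN, Box.coord_cast, Shape.op_degen, decide_eq_true_eq]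
      grind
    have h3 : cap 0 x = X.act x ((Box.raise (fun _ => true) ≫ s) ≫ Box.endMap N) := by
      refine congrArg _ (Box.hom_ext_coord fun v l => ?_)
      simp (disch := omega) only [s, Box.coord_comp, Box.coord_raise, Box.coord_endMap,
        Box.coord_degN, Box.coord_cast, Shape.op_degen, decide_eq_true_eq]
      grind
    rw [h2, h3, h1, h1]

/-- The two conditions match the data of a map out of a cone: a point for the apex, and a map to the
path object whose end at 1 is constant at that point. -/
theorem isCone_succ_iff {n N : ℕ} (x : X.cubes (1 + N)) : IsCone (n + 1) x ↔
    (∃ p : X.cubes 0, X.act x (Box.endMap N) = X.act p (Box.toZero _)) ∧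
      IsCone (X := path X) (N := N) n x := by
  rw [isCone_path_iff, ← top_zero_eq_cap_zero_iff]
  constructor
  · exact fun h => ⟨h 0 (by omega), fun i hi => h (i + 1) (by omega)⟩
  · rintro ⟨h, h'⟩ i hi
    obtain _ | i := i
    · exact h
    · exact h' i (by omega)

theorem isCone_act_cast {a b n : ℕ} (h : a = b) (x : X.cubes b) :
    IsCone n (X.act x (Box.cast h)) ↔ IsCone n x := by
  subst h
  have : Box.cast (rfl : a = a) = 𝟙 _ := rfl
  rw [this, act_id]

theorem toCube_cubeMap_comp {m n : ℕ} (p : Box.mk m ⟶ Box.mk n) (F : cube.{u} n ⟶ X) :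
    toCube (cubeMap p ≫ F) = X.act (toCube F) p :=
  (uliftYonedaEquiv_naturality F p.op).symm

/-- One layer of the cone construction is traded for passing from `X` to `path X`. Hence the
inductions below keep `X` universally quantified. -/
theorem toCube_coneQuot_succ {m n : ℕ} (y : Cone X m (n + 1)) :
    toCube (coneQuot m (n + 1) ≫ y) = X.act (n := 1 + (m + n))
      (toCube (X := path X) (coneQuot m n ≫ curry (pushout.inr (toPoint (stdCone.{u} m n))
        (endIncl (stdCone m n)) ≫ y))) (Box.cast (Nat.add_comm (m + n) 1)) := by
  have h : coneQuot m (n + 1) ≫ y = cubeMap (Box.cast (Nat.add_comm (m + n) 1)) ≫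
      cubeToTensor 1 (m + n) ≫ tensorMap (𝟙 _) (coneQuot m n) ≫
      pushout.inr (toPoint (stdCone.{u} m n)) (endIncl (stdCone m n)) ≫ y := by
    simp only [coneQuot, Category.assoc]
    exact congrArg (fun t => cubeMap _ ≫ cubeToTensor _ _ ≫ t) (Category.assoc _ _ _)
  rw [h, toCube_cubeMap_comp]
  congr 1

theorem uncurry_app_self (F : Y ⟶ path X) {n : ℕ} (y : Y.cubes n) :
    (uncurry F).app (op (Box.mk (1 + n)))
      (tensorMk (ULift.up (𝟙 (Box.mk 1))) y (𝟙 (Box.mk (1 + n)))) =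
      F.app (op (Box.mk n)) y := by
  rw [uncurry_tensorMk, Box.prod_id, Category.comp_id]
  exact act_id X (n := 1 + n) _

theorem curry_uncurry (F : Y ⟶ path X) : curry (uncurry F) = F := by
  ext k y
  exact uncurry_app_self F (n := k.unop.dim) y

theorem app_toPoint_comp {n : ℕ} (F : cube.{u} 0 ⟶ X) (y : Y.cubes n) :
    (toPoint Y ≫ F).app (op (Box.mk n)) y = X.act (toCube F) (Box.toZero (Box.mk n)) := by
  rw [← toCube_cubeMap_comp, toCube, uliftYonedaEquiv_comp, uliftYonedaEquiv_uliftYoneda_map]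
  rfl

theorem endIncl_comp_app {n : ℕ} (G : tensor (cube.{u} 1) Y ⟶ X) (y : Y.cubes n) :
    (endIncl Y ≫ G).app (op (Box.mk n)) y =
      X.act (n := 1 + n) ((curry G).app (op (Box.mk n)) y) (Box.endMap n) := by
  refine Eq.trans (congrArg (G.app (op (Box.mk n))) (endIncl_app y)) ?_
  exact map_act G (n := 1 + n) _ _

theorem isCone_toCube (m n : ℕ) :
    ∀ {X : CSet.{u}} (y : Cone X m n), IsCone n (toCube (coneQuot m n ≫ y)) := by
  induction n with
  | zero => exact fun y => isCone_zero _
  | succ n ih =>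
    intro X y
    rw [toCube_coneQuot_succ]
    refine (isCone_act_cast _ _).2 ((isCone_succ_iff _).2 ⟨?_, ih _⟩)
    refine ⟨toCube (pushout.inl (toPoint (stdCone.{u} m n)) (endIncl (stdCone m n)) ≫ y), ?_⟩
    have h : toPoint (stdCone.{u} m n) ≫
        pushout.inl (toPoint (stdCone.{u} m n)) (endIncl (stdCone m n)) ≫ y =
        endIncl (stdCone.{u} m n) ≫
          pushout.inr (toPoint (stdCone.{u} m n)) (endIncl (stdCone m n)) ≫ y :=
      pushout.condition_assoc (f := toPoint (stdCone.{u} m n)) (g := endIncl (stdCone m n)) y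
    have h' := congrArg (fun t => (t.app (op (Box.mk (m + n)))) (toCube (coneQuot m n))) h
    dsimp only at h'
    rw [app_toPoint_comp, endIncl_comp_app] at h'
    rw [h', toCube, uliftYonedaEquiv_comp]

theorem exists_cone_of_isCone (m n : ℕ) :
    ∀ {X : CSet.{u}} (x : X.cubes (m + n)), IsCone n x →
      ∃ y : Cone X m n, toCube (coneQuot m n ≫ y) = x := by
  induction n with
  | zero =>
    intro X x _
    refine ⟨ofCube x, ?_⟩
    have : coneQuot m 0 ≫ ofCube x = ofCube x := Category.id_comp _
    rw [this]
    exact Equiv.apply_symm_apply _ _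
  | succ n ih =>
    intro X x hx
    have hx' := (isCone_act_cast (Nat.add_comm 1 (m + n)) x).2 hx
    obtain ⟨⟨p, hp⟩, hx'⟩ := (isCone_succ_iff _).1 hx'
    obtain ⟨F, hF⟩ := ih (X := path X) _ hx'
    have hcomp : toPoint (stdCone.{u} m n) ≫ ofCube p =
        endIncl (stdCone.{u} m n) ≫ uncurry F := by
      -- The two maps on the standard cone need only be compared on its universal cube, where the
      -- equation becomes `hp`.
      rw [← cancel_epi (coneQuot m n)]
      refine uliftYonedaEquiv.{u}.injective ?_
      rw [uliftYonedaEquiv_comp, uliftYonedaEquiv_comp, app_toPoint_comp, endIncl_comp_app,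
        curry_uncurry, ← uliftYonedaEquiv_comp]
      have h1 : toCube (ofCube p) = p := Equiv.apply_symm_apply _ _
      rw [h1, ← hp]
      exact congrArg (fun t : X.cubes (1 + (m + n)) => X.act t (Box.endMap (m + n))) hF.symm
    refine ⟨pushout.desc _ _ hcomp, ?_⟩
    have h : curry (pushout.inr (toPoint (stdCone.{u} m n)) (endIncl (stdCone m n)) ≫
        pushout.desc _ _ hcomp) = F :=
      (congrArg curry (pushout.inr_desc _ _ _)).trans (curry_uncurry F)
    have h' := (congrArg (fun t => toCube (coneQuot m n ≫ t)) h).trans hF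
    refine (toCube_coneQuot_succ _).trans ?_
    refine (congrArg (fun t : X.cubes (1 + (m + n)) => X.act t (Box.cast _)) h').trans ?_
    refine act_eq_self fun v l => ?_
    rw [Box.coord_cast, Box.coord_cast]

theorem Cone.isCone_cube {m n : ℕ} (y : Cone X m n) (N : ℕ) (h : N = m + n) :
    IsCone n (y.cube N h) := by
  subst h
  exact (isCone_act_cast _ _).2 (isCone_toCube m n y)

theorem exists_cone_cube_eq {m n N : ℕ} (h : N = m + n) {x : X.cubes N} (hx : IsCone n x) :
    ∃ y : Cone X m n, y.cube N h = x := by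
  subst h
  obtain ⟨y, rfl⟩ := exists_cone_of_isCone m n x hx
  exact ⟨y, act_id X _⟩

/-! ### From functions on cubes to functions on cones -/

theorem d_eq_act {N i : ℕ} (hi : i < N + 1) (ε : Bool) (x : X.cubes (N + 1)) :
    d i ε x = X.act x (Box.face ⟨i, hi⟩ ε) := by
  rw [d, Box.faceN_eq]

theorem degen_eq_act {N i : ℕ} (hi : i < N + 1) (x : X.cubes N) :
    e .degen i x = X.act x (Box.degen ⟨i, hi⟩) := by
  rw [e, Box.degN_degen_eq]

theorem conn_eq_act {N i : ℕ} (hi : i < N) (ε : Bool) (x : X.cubes N) :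
    e (.conn ε) i x = X.act x (Box.conn ⟨i, hi⟩ ε) := by
  rw [e, Box.degN_conn_eq]

/-- Functions on cubes satisfying the identities of a coherent family of composites give rise to
such a family. -/
theorem isCoherentFamily_of_theta (θ : ∀ N : ℕ, ℕ → X.cubes N → X.cubes (N + 1))
    (hb : ∀ N, Base (θ N)) (hr : ∀ N, Rel (θ N) (θ (N + 1))) :
    ∃ θ : ∀ m n : ℕ, X.Cone m n → X.Cone m (n + 1), X.IsCoherentFamily θ := by
  -- Quantifying over `N` with `N = m + n` avoids casts between forms of the dimension such as `m +
  -- 1 + n` and `m + n + 1`.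
  have hex : ∀ (m n : ℕ) (x : Cone X m n), ∃ y : Cone X m (n + 1),
      ∀ (N : ℕ) (h : N = m + n), y.cube (N + 1) (by omega) = θ N n (x.cube N h) := fun m n x => by
    obtain ⟨y, hy⟩ := exists_cone_cube_eq (m := m) (n := n + 1) (N := m + n + 1) rfl
      ((hb (m + n) n (by omega) (x.cube (m + n)) (x.isCone_cube _ rfl)).isCone)
    refine ⟨y, fun N h => ?_⟩
    subst h
    exact hy
  choose Θ hΘ using hex
  refine ⟨Θ, ?_, ?_, ?_, ?_, ?_, ?_, ?_, ?_⟩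
  · intro m n x i hi
    have hx := x.isCone_cube (m + n + 1) rfl
    obtain ⟨y, hy⟩ := exists_cone_cube_eq (m := m) (n := n) (N := m + n) rfl
      (hx.d (i := i) (n' := n) (by omega) (by omega) (by omega) false)
    refine ⟨y, by rw [hy, d_eq_act], ?_⟩
    rw [hΘ m (n + 1) x (m + n + 1) rfl, hΘ m n y (m + n) rfl, hy, ← d_eq_act (by omega),
      (hr _ _ (by omega) _ hx).zero n rfl i (by omega)]
  · intro m n x
    rw [hΘ m n x (m + n) rfl, ← d_eq_act (by omega),
      (hb _ _ (by omega) _ (x.isCone_cube _ rfl)).self]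
  · intro m n x i hi hni
    have hx := x.isCone_cube (m + n + 1) (by omega)
    obtain ⟨y, hy⟩ := exists_cone_cube_eq (m := m) (n := n) (N := m + n) rfl
      (hx.d (i := i) (n' := n) (by omega) (by omega) (by omega) true)
    refine ⟨y, by rw [hy, d_eq_act], ?_⟩
    rw [hΘ (m + 1) n x (m + n + 1) (by omega), hΘ m n y (m + n) rfl, hy, ← d_eq_act (by omega),
      (hr _ _ (by omega) _ hx).one i hni (by omega)]
  · intro m n x i hi hni
    have hx := x.isCone_cube (m + n) rfl
    have hc := hx.e .degen hni (by omega)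
    obtain ⟨y, hy⟩ := exists_cone_cube_eq (m := m + 1) (n := n) (N := m + n + 1) (by omega) hc
    refine ⟨y, by rw [hy, degen_eq_act], ?_⟩
    rw [hΘ (m + 1) n y (m + n + 1) (by omega), hΘ m n x (m + n) rfl, hy, ← degen_eq_act (by omega),
      (hr _ _ (by omega) _ hc).hi .degen i _ hni (by simpa using hi) hx rfl]
  · intro m n x i hi
    have hx := x.isCone_cube (m + n) rfl
    have hc := hx.conn_lo hi (by omega)
    obtain ⟨y, hy⟩ := exists_cone_cube_eq (m := m) (n := n + 1) (N := m + n + 1) rfl hc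
    refine ⟨y, by rw [hy, conn_eq_act], ?_⟩
    rw [hΘ m (n + 1) y (m + n + 1) rfl, hΘ m n x (m + n) rfl, hy, ← conn_eq_act (by omega),
      (hr _ _ (by omega) _ hc).lo n i _ rfl hi hx rfl]
  · intro m n x i hi ε hni
    have hx := x.isCone_cube (m + n) rfl
    have hc := hx.e (.conn ε) hni (by omega)
    obtain ⟨y, hy⟩ := exists_cone_cube_eq (m := m + 1) (n := n) (N := m + n + 1) (by omega) hc
    refine ⟨y, by rw [hy, conn_eq_act], ?_⟩
    rw [hΘ (m + 1) n y (m + n + 1) (by omega), hΘ m n x (m + n) rfl, hy, ← conn_eq_act (by omega),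
      (hr _ _ (by omega) _ hc).hi (.conn ε) i _ hni (by simp; omega) hx rfl]
  · intro m n x
    have hx := x.isCone_cube (m + n) rfl
    have hc := (hb _ n (by omega) _ hx).isCone
    rw [hΘ m (n + 1) (Θ m n x) (m + n + 1) rfl, hΘ m n x (m + n) rfl, ← conn_eq_act (by omega),
      (hr _ _ (by omega) _ hc).self n _ rfl hx rfl]
  · intro m n x
    have hx := x.isCone_cube (m + n + 1) rfl
    obtain ⟨y, hy⟩ := exists_cone_cube_eq (m := m + 1) (n := n) (N := m + n + 1) (by omega)
      (hx.mono (Nat.le_succ n))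
    refine ⟨y, hy, ?_⟩
    rw [hΘ (m + 1) n y (m + n + 1) (by omega), hy, ← conn_eq_act (by omega),
      (hb _ n (by omega) _ (hx.mono (Nat.le_succ n))).cone hx]

end CSet
end Cubical

/-- Every cubical quasicategory admits a coherent family of composites. -/
theorem mainTheorem10 (X : Cubical.CSet.{u}) (hX : X.IsQuasicategory) :
    ∃ θ : ∀ m n : ℕ, X.Cone m n → X.Cone m (n + 1), X.IsCoherentFamily θ := by
  exact Cubical.CSet.isCoherentFamily_of_theta (Cubical.CSet.theta X)
    (fun N => (Cubical.CSet.base_theta_and_rel_theta hX N).1)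
    (fun N => (Cubical.CSet.base_theta_and_rel_theta hX N).2.2)
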